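/- Let $\mathcal A$ be a central hyperplane arrangement, that is, a finite set of linear hyperplanes in a finite-dimensional real vector space $V$, with fixed positive and negative sides $H^+,H^-$ of each $H\in\mathcal A$ (and $H^0=H$), and let $k$ be a field of any characteristic. A face of $\mathcal A$ is a nonempty set $x=\bigcap_{H} H^{\sigma_H(x)}$ with $\sigma_H(x)\in\{+,-,0\}$. Faces are ordered by $x\le y$ iff for every $H$ either $\sigma_H(x)=0$ or $\sigma_H(x)=\sigma_H(y)$. The set $\mathcal F$ of faces is a monoid, where $\sigma_H(xy)=\sigma_H(x)$ if $\sigma_H(x)\ne 0$ and $\sigma_H(xy)=\sigma_H(y)$ otherwise; let $k\mathcal F$ be its monoid algebra. The support of $x$ is $\operatorname{supp}(x)=\bigcap_{\sigma_H(x)=0}H$, and $\mathcal L=\operatorname{supp}(\mathcal F)$ is ordered by inclusion. For each $X\in\mathcal L$ fix a face $x$ of support $X$, and define $e_X\in k\mathcal F$ recursively by $e_X=x-\sum_{Y>X}x\,e_Y$. Fix an orientation $\epsilon_X$ of every $X\in\mathcal L$. If $y\lessdot x$ in $\mathcal F$, let $[y:x]\in\{1,-1\}$ be $\epsilon_{\operatorname{supp}(x)}(b_1,\dots,b_i,v)$,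 where $b_1,\dots,b_i$ is a positively oriented basis of $\operatorname{supp}(y)$ and $v\in x$ (equivalently, $\epsilon_{\operatorname{supp}(y)}(b_1,\dots,b_i)\,\epsilon_{\operatorname{supp}(x)}(b_1,\dots,b_i,v)$ for any basis $b_1,\dots,b_i$ of $\operatorname{supp}(y)$). Put $\partial(y)=\sum_{x\gtrdot y}[y:x]\,x\in k\mathcal F$. Let $\mathcal Q$ be the quiver with vertex set $\mathcal L$ and exactly one arrow $X\to Y$ if $X\gtrdot Y$, and none otherwise. Let $k\mathcal Q$ be its path algebra, in which $p\cdot q$ is the path $q$ followed by $p$ if $p$ starts where $q$ ends, and $0$ otherwise. Let $P$ be the ideal of $k\mathcal Q$ generated by the arrows. An ideal $I$ of $k\mathcal Q$ is admissible if $P^r\subseteq I\subseteq P^2$ for some $r\ge 2$, and a relation is an element of $I$ that is a linear combination of paths with the same start and the same end. Then there is a unique $k$-algebra homomorphism $\varphi:k\mathcal Q\to k\mathcal F$ with $\varphi(X)=e_X$ for every vertex $X$ and $\varphi(X\to Y)=e_Y\,\partial(y)\,e_X$ for every arrow $X\to Y$, where $y$ is the face chosen for $Y$. For every interval $[Z,X]$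 of length two in $\mathcal L$, the sum of all paths of length two from $X$ to $Z$, $$\sum_{Y\in(Z,X)}(X\to Y\to Z),$$ lies in $\ker\varphi$. The ideal $\ker\varphi$ is admissible, and the set $R$ of these sums is a minimal generating set of relations for it: its elements are relations, it generates $\ker\varphi$ as a two-sided ideal, and no proper subset of it does. Moreover $\varphi$ induces an isomorphism of $k$-algebras $k\mathcal Q/\langle R\rangle\cong k\mathcal F$. -/

import Mathlib

/-! ### Path algebras and relations of quivers -/

/-- A path of the quiver `Q`, together with its endpoints. -/
structure QuiverPath (Q : Type*) [Quiver Q] where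
  source : Q
  target : Q
  path : Quiver.Path source target

/-- The path algebra `kQ`: the `k`-vector space with basis the paths of `Q`. -/
def PathAlgebra (k Q : Type*) [Field k] [Quiver Q] : Type _ := QuiverPath Q →₀ k

namespace PathAlgebra

variable {k Q : Type*} [Field k] [Quiver Q]

noncomputable instance : AddCommGroup (PathAlgebra k Q) :=
  inferInstanceAs (AddCommGroup (QuiverPath Q →₀ k))

noncomputable instance : Module k (PathAlgebra k Q) :=
  inferInstanceAs (Module k (QuiverPath Q →₀ k))

/-- The basis of `kQ` consisting of the paths of `Q`. -/
noncomputable def basis (k Q : Type*) [Field k] [Quiver Q] :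
    Module.Basis (QuiverPath Q) k (PathAlgebra k Q) :=
  Module.Basis.ofRepr (LinearEquiv.refl k (QuiverPath Q →₀ k))

/-- The basis element of `kQ` given by a path `p` from `a` to `b`. -/
noncomputable def ofPath (k : Type*) [Field k] {Q : Type*} [Quiver Q] {a b : Q}
    (p : Quiver.Path a b) : PathAlgebra k Q :=
  basis k Q ⟨a, b, p⟩

/-- The basis element of `kQ` given by the path of length zero at the vertex `a`. -/
noncomputable def vertex (k : Type*) [Field k] {Q : Type*} [Quiver Q] (a : Q) :
    PathAlgebra k Q :=
  ofPath k (Quiver.Path.nil : Quiver.Path a a)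

/-- The basis element of `kQ` given by an arrow `a ⟶ b`. -/
noncomputable def arrow (k : Type*) [Field k] {Q : Type*} [Quiver Q] {a b : Q} (f : a ⟶ b) :
    PathAlgebra k Q :=
  ofPath k f.toPath

open Classical in
/-- The product `p · q` of two paths: first `q` and then `p` if `p` starts where `q` terminates,
and zero otherwise. -/
noncomputable def pathMul (k : Type*) [Field k] {Q : Type*} [Quiver Q] (p q : QuiverPath Q) :
    PathAlgebra k Q :=
  if h : q.target = p.source then ofPath k ((q.path.cast rfl h).comp p.path) else 0

/-- The bilinear extension of the product of paths. -/
noncomputable def mulMap (k Q : Type*) [Field k] [Quiver Q] :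
    PathAlgebra k Q →ₗ[k] PathAlgebra k Q →ₗ[k] PathAlgebra k Q :=
  (basis k Q).constr k fun p => (basis k Q).constr k fun q => pathMul k p q

noncomputable instance : Mul (PathAlgebra k Q) := ⟨fun x y => mulMap k Q x y⟩

noncomputable instance [Fintype Q] : One (PathAlgebra k Q) := ⟨∑ a : Q, vertex k a⟩

theorem mul_def (x y : PathAlgebra k Q) : x * y = mulMap k Q x y := rfl

theorem one_def [Fintype Q] : (1 : PathAlgebra k Q) = ∑ a : Q, vertex k a := rfl

theorem ofPath_mul_ofPath {a b c : Q} (p : Quiver.Path b c) (q : Quiver.Path a b) :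
    ofPath k p * ofPath k q = ofPath k (q.comp p) := by
  simp [mul_def, mulMap, ofPath, pathMul]

theorem ofPath_mul_ofPath_of_ne {a b c d : Q} (p : Quiver.Path c d) (q : Quiver.Path a b)
    (h : b ≠ c) : ofPath k p * ofPath k q = 0 := by
  simp [mul_def, mulMap, ofPath, pathMul, h]

theorem induction_on {P : PathAlgebra k Q → Prop} (x : PathAlgebra k Q)
    (h0 : P 0) (hadd : ∀ x y, P x → P y → P (x + y))
    (h : ∀ (r : k) {a b : Q} (p : Quiver.Path a b), P (r • ofPath k p)) : P x := by
  rw [← (basis k Q).linearCombination_repr x]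
  induction (basis k Q).repr x using Finsupp.induction_linear with
  | zero => simpa using h0
  | add f g hf hg => simpa using hadd _ _ hf hg
  | single p r => simpa [ofPath] using h r p.path

noncomputable instance : NonUnitalNonAssocRing (PathAlgebra k Q) where
  left_distrib x y z := by simp [mul_def]
  right_distrib x y z := by simp [mul_def]
  zero_mul x := by simp [mul_def]
  mul_zero x := by simp [mul_def]

instance : IsScalarTower k (PathAlgebra k Q) (PathAlgebra k Q) :=
  ⟨fun r x y => by simp [mul_def]⟩

instance : SMulCommClass k (PathAlgebra k Q) (PathAlgebra k Q) :=
  ⟨fun r x y => by simp [mul_def]⟩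

theorem mul_assoc' (x y z : PathAlgebra k Q) : x * y * z = x * (y * z) := by
  induction x using induction_on with
  | h0 => simp
  | hadd x x' hx hx' => simp [add_mul, hx, hx']
  | h r p =>
  induction y using induction_on with
  | h0 => simp
  | hadd x x' hx hx' => simp only [add_mul, mul_add, hx, hx']
  | h s q =>
  induction z using induction_on with
  | h0 => simp
  | hadd x x' hx hx' => simp only [mul_add, hx, hx']
  | h t w =>
  rename_i a b c d e f
  simp only [smul_mul_assoc, mul_smul_comm]
  by_cases h₁ : d = a
  · subst h₁
    by_cases h₂ : f = c
    · subst h₂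
      simp [ofPath_mul_ofPath]
    · simp [ofPath_mul_ofPath, ofPath_mul_ofPath_of_ne _ _ h₂]
  · by_cases h₂ : f = c
    · subst h₂
      simp [ofPath_mul_ofPath, ofPath_mul_ofPath_of_ne _ _ h₁]
    · simp [ofPath_mul_ofPath_of_ne _ _ h₁, ofPath_mul_ofPath_of_ne _ _ h₂]

theorem one_mul' [Fintype Q] (x : PathAlgebra k Q) : 1 * x = x := by
  classical
  induction x using induction_on with
  | h0 => simp
  | hadd x x' hx hx' => simp [mul_add, hx, hx']
  | @h r a b p =>
  rw [mul_smul_comm, one_def, Finset.sum_mul, Finset.sum_eq_single b]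
  · simp [vertex, ofPath_mul_ofPath]
  · intro c _ hc
    exact ofPath_mul_ofPath_of_ne _ _ hc.symm
  · simp

theorem mul_one' [Fintype Q] (x : PathAlgebra k Q) : x * 1 = x := by
  classical
  induction x using induction_on with
  | h0 => simp
  | hadd x x' hx hx' => simp [add_mul, hx, hx']
  | @h r a b p =>
  rw [smul_mul_assoc, one_def, Finset.mul_sum, Finset.sum_eq_single a]
  · simp [vertex, ofPath_mul_ofPath]
  · intro c _ hc
    exact ofPath_mul_ofPath_of_ne _ _ hc
  · simp

noncomputable instance [Fintype Q] : Ring (PathAlgebra k Q) :=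
  { (inferInstance : NonUnitalNonAssocRing (PathAlgebra k Q)) with
    mul_assoc := mul_assoc'
    one := 1
    one_mul := one_mul'
    mul_one := mul_one' }

noncomputable instance [Fintype Q] : Algebra k (PathAlgebra k Q) :=
  Algebra.ofModule smul_mul_assoc mul_smul_comm

/-- The two-sided ideal of `kQ` generated by the arrows, as a subspace of `kQ`. -/
noncomputable def arrowIdeal (k Q : Type*) [Field k] [Quiver Q] [Fintype Q] :
    Submodule k (PathAlgebra k Q) :=
  (TwoSidedIdeal.asIdeal (TwoSidedIdeal.span
    {x : PathAlgebra k Q | ∃ (a b : Q) (f : a ⟶ b), x = arrow k f})).restrictScalars k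

/-- An ideal `I` of `kQ` is admissible if `P ^ r ⊆ I ⊆ P ^ 2` for some `r ≥ 2`, where `P` is the
ideal generated by the arrows. -/
def IsAdmissible [Fintype Q] (I : TwoSidedIdeal (PathAlgebra k Q)) : Prop :=
  (∃ r : ℕ, 2 ≤ r ∧ ∀ x ∈ arrowIdeal k Q ^ r, x ∈ I) ∧ ∀ x ∈ I, x ∈ arrowIdeal k Q ^ 2

/-- An element of `I` is a relation from `a` to `b` if it is a linear combination of paths
from `a` to `b`. -/
def IsRelation [Fintype Q] (I : TwoSidedIdeal (PathAlgebra k Q)) (a b : Q)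
    (x : PathAlgebra k Q) : Prop :=
  x ∈ I ∧ x ∈ Submodule.span k (Set.range fun p : Quiver.Path a b => ofPath k p)

/-- `R` is a minimal set of relations generating `I` as a two-sided ideal: its elements are
relations, it generates `I`, and no proper subset of it generates `I`. -/
def IsMinimalRelations [Fintype Q] (I : TwoSidedIdeal (PathAlgebra k Q))
    (R : Set (PathAlgebra k Q)) : Prop :=
  (∀ x ∈ R, ∃ a b : Q, IsRelation I a b x) ∧ TwoSidedIdeal.span R = I ∧
    ∀ S : Set (PathAlgebra k Q), S ⊂ R → TwoSidedIdeal.span S ≠ I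

end PathAlgebra

/-! ### The quiver of a poset -/

/-- The Hasse diagram of a poset `P` as a quiver: the vertices are the elements of `P`, and there
is exactly one arrow `X ⟶ Y` if `X` covers `Y`, and none otherwise. -/
def HasseQuiver (P : Type*) : Type _ := P

instance (P : Type*) [Preorder P] : Quiver (HasseQuiver P) :=
  ⟨fun X Y => PLift (@CovBy P _ Y X)⟩

instance (P : Type*) [Fintype P] : Fintype (HasseQuiver P) := inferInstanceAs (Fintype P)

/-- The element `X` of `P` as a vertex of the Hasse quiver. -/
def HasseQuiver.of {P : Type*} (X : P) : HasseQuiver P := X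

/-- The arrow `X ⟶ Y` given by a cover relation. -/
def HasseQuiver.arrow {P : Type*} [Preorder P] {X Y : P} (h : Y ⋖ X) :
    HasseQuiver.of X ⟶ HasseQuiver.of Y := PLift.up h

open Classical in
/-- The sum in `kQ` of all paths `X → Y → Z` of length two from `X` to `Z`, where `Q` is the Hasse
quiver of `P`. -/
noncomputable def sumPathsTwo (k : Type*) [Field k] {P : Type*} [Preorder P] [Fintype P]
    (Z X : P) : PathAlgebra k (HasseQuiver P) :=
  ∑ Y : {Y : P // Z ⋖ Y ∧ Y ⋖ X},
    PathAlgebra.ofPath k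
      ((HasseQuiver.arrow Y.2.2).toPath.comp (HasseQuiver.arrow Y.2.1).toPath)

/-- The length of the poset `[Z, X]`, that is, of the longest chain in it, is two. -/
def IntervalLengthTwo {P : Type*} [Preorder P] (Z X : P) : Prop :=
  Order.krullDim (Set.Icc Z X) = 2

/-! ### Hyperplane arrangements, faces and supports -/

/-- A central hyperplane arrangement in a real vector space `V`: a finite set of linear
hyperplanes, with a linear form for each hyperplane `H` that has kernel `H` and so fixes which of
the two open half-spaces is `H⁺` (where the form is positive) and which is `H⁻`. -/
structure CentralArrangement (V : Type*) [AddCommGroup V] [Module ℝ V] where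
  hyperplanes : Finset (Submodule ℝ V)
  isCoatom : ∀ H ∈ hyperplanes, IsCoatom H
  form : hyperplanes → Module.Dual ℝ V
  ker_form : ∀ H : hyperplanes, LinearMap.ker (form H) = H

namespace CentralArrangement

variable {V : Type*} [AddCommGroup V] [Module ℝ V]

/-- A face of the arrangement, given by its sign sequence `σ`: the intersection of the sets
`H ^ σ H` has to be nonempty. -/
@[ext]
structure Face (A : CentralArrangement V) where
  sign : A.hyperplanes → SignType
  nonempty : ∃ v : V, ∀ H, SignType.sign (A.form H v) = sign H

namespace Face

variable {A : CentralArrangement V}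

/-- The face as a subset of `V`, the intersection of the sets `H ^ σ H`. -/
def carrier (x : Face A) : Set V := {v | ∀ H, SignType.sign (A.form H v) = x.sign H}

instance : Finite (Face A) :=
  Finite.of_injective (fun x : Face A => x.sign) fun _ _ h => Face.ext h

noncomputable instance : Fintype (Face A) := Fintype.ofFinite _

instance : PartialOrder (Face A) where
  le x y := ∀ H, x.sign H = 0 ∨ x.sign H = y.sign H
  le_refl x H := Or.inr rfl
  le_trans x y z hxy hyz H := by
    rcases hxy H with h | h
    · exact Or.inl h
    · rw [h]
      exact hyz H
  le_antisymm x y hxy hyx := by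
    ext H
    rcases hxy H with h | h
    · rcases hyx H with h' | h'
      · rw [h, h']
      · exact h'.symm
    · exact h

theorem le_def {x y : Face A} : x ≤ y ↔ ∀ H, x.sign H = 0 ∨ x.sign H = y.sign H := Iff.rfl

/-- The product `x y` has sign `σ_H(x)` at `H` if this is not zero, and `σ_H(y)` otherwise. -/
instance : Mul (Face A) where
  mul x y :=
    { sign := fun H => if x.sign H = 0 then y.sign H else x.sign H
      nonempty := by
        obtain ⟨v, hv⟩ := x.nonempty
        obtain ⟨w, hw⟩ := y.nonempty
        have key : ∀ H, ∀ᶠ t : ℝ in nhdsWithin 0 (Set.Ioi 0),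
            SignType.sign (A.form H (v + t • w)) =
              if x.sign H = 0 then y.sign H else x.sign H := by
          intro H
          rw [← hv, ← hw]
          by_cases h0 : A.form H v = 0
          · filter_upwards [self_mem_nhdsWithin] with t ht
            have ht' : (0 : ℝ) < t := ht
            simp [h0, sign_mul, sign_pos ht']
          · have hs : ¬ SignType.sign (A.form H v) = 0 := by simpa using h0
            rw [if_neg hs]
            have hc : Filter.Tendsto (fun t : ℝ => A.form H v + t * A.form H w)
                (nhdsWithin 0 (Set.Ioi 0)) (nhds (A.form H v)) := by
              have : Continuous fun t : ℝ => A.form H v + t * A.form H w := by fun_prop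
              simpa using (this.tendsto 0).mono_left nhdsWithin_le_nhds
            rcases lt_or_gt_of_ne h0 with h | h
            · filter_upwards [hc.eventually (gt_mem_nhds h)] with t ht
              simp only [map_add, map_smul, smul_eq_mul]
              rw [sign_neg ht, sign_neg h]
            · filter_upwards [hc.eventually (lt_mem_nhds h)] with t ht
              simp only [map_add, map_smul, smul_eq_mul]
              rw [sign_pos ht, sign_pos h]
        obtain ⟨t, ht⟩ := (Filter.eventually_all.2 key).exists
        exact ⟨v + t • w, ht⟩ }

theorem mul_sign (x y : Face A) (H : A.hyperplanes) :
    (x * y).sign H = if x.sign H = 0 then y.sign H else x.sign H := rfl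

/-- The identity is the intersection of all the hyperplanes. -/
instance : One (Face A) where
  one := { sign := fun _ => 0, nonempty := ⟨0, fun H => by simp⟩ }

theorem one_sign (H : A.hyperplanes) : (1 : Face A).sign H = 0 := rfl

instance : Monoid (Face A) where
  mul_assoc x y z := by
    ext H
    simp only [mul_sign]
    split_ifs <;> simp_all
  one_mul x := by
    ext H
    simp [mul_sign, one_sign]
  mul_one x := by
    ext H
    simp only [mul_sign, one_sign]
    split_ifs with h
    · exact h.symm
    · rfl

/-- The support of a face: the intersection of the hyperplanes that contain it. -/
def supp (x : Face A) : Submodule ℝ V := ⨅ H : {H : A.hyperplanes // x.sign H = 0}, H.1.1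

theorem supp_mono {x y : Face A} (h : x ≤ y) : supp x ≤ supp y := by
  refine le_iInf fun H => ?_
  have hx : x.sign H.1 = 0 := by
    rcases h H.1 with h' | h'
    · exact h'
    · rw [h', H.2]
  exact iInf_le (fun H : {H : A.hyperplanes // x.sign H = 0} => H.1.1) ⟨H.1, hx⟩

theorem mem_supp_of_mem_carrier {x : Face A} {v : V} (hv : v ∈ carrier x) : v ∈ supp x := by
  refine (Submodule.mem_iInf _).2 fun H => ?_
  rw [← A.ker_form H.1, LinearMap.mem_ker]
  have := hv H.1
  rwa [H.2, sign_eq_zero_iff] at this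

end Face

/-- The intersection lattice `L`: the supports of the faces, ordered by inclusion. -/
abbrev IntersectionLattice (A : CentralArrangement V) : Type _ :=
  Set.range (Face.supp : Face A → Submodule ℝ V)

noncomputable instance (A : CentralArrangement V) : Fintype (IntersectionLattice A) :=
  Fintype.ofFinite _

/-- The support of a face as an element of the intersection lattice. -/
def Face.support {A : CentralArrangement V} (x : Face A) : IntersectionLattice A :=
  ⟨x.supp, x, rfl⟩

/-! ### Orientations and incidence numbers -/

/-- An orientation of every subspace in the intersection lattice. -/
abbrev Orientations (A : CentralArrangement V) : Type _ :=
  ∀ X : IntersectionLattice A, Orientation ℝ X.1 (Fin (Module.finrank ℝ X.1))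

/-- The sign `+1`, `-1` or `0` of a tuple `u` of `n` vectors with respect to an orientation of
an `n`-dimensional space: the sign at `u` of any alternating form that represents it. -/
noncomputable def orientationSign {M : Type*} [AddCommGroup M] [Module ℝ M] {n : ℕ}
    (o : Orientation ℝ M (Fin n)) (u : Fin n → M) : SignType :=
  SignType.sign (o.someVector u)

open Classical in
/-- The incidence number `[x : y] = ε_X(b₁, …, bᵢ) ε_Y(b₁, …, bᵢ, v)` of a codimension one face
`x` of `y`, where `X` and `Y` are the supports of `x` and `y`, `b₁, …, bᵢ` is a basis of `X` and
`v` is a vector in `y`. It does not depend on the choice of the basis and of `v`; for a positively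
oriented basis the first factor is `1`. -/
noncomputable def incidence {A : CentralArrangement V} [FiniteDimensional ℝ V]
    (ε : Orientations A) {x y : Face A} (h : x ⋖ y) : SignType :=
  let b := Module.finBasis ℝ x.supp
  let v : y.supp := ⟨y.nonempty.choose, Face.mem_supp_of_mem_carrier y.nonempty.choose_spec⟩
  orientationSign (ε x.support) b *
    orientationSign (ε y.support) fun j : Fin (Module.finrank ℝ y.supp) =>
      if hj : (j : ℕ) < Module.finrank ℝ x.supp then
        Submodule.inclusion (Face.supp_mono h.le) (b ⟨j, hj⟩)
      else v

/-! ### The face semigroup algebra -/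

/-- The face semigroup algebra `kF`. -/
abbrev FaceAlgebra (k : Type*) [Field k] (A : CentralArrangement V) : Type _ :=
  MonoidAlgebra k (Face A)

open Classical in
/-- The element `∂(y) = ∑ [y : x] x` of `kF`, where the sum is over the faces `x` that cover `y`. -/
noncomputable def boundary (k : Type*) [Field k] {A : CentralArrangement V}
    [FiniteDimensional ℝ V] (ε : Orientations A) (y : Face A) : FaceAlgebra k A :=
  ∑ x : {x : Face A // y ⋖ x}, MonoidAlgebra.single x.1 ((incidence ε x.2 : SignType) : k)

open Classical in
/-- The elements `e_X` of `kF` with `e_X = x - ∑_{Y > X} x e_Y`, where `x = c X` is the face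
chosen for `X`. -/
noncomputable def idem (k : Type*) [Field k] {A : CentralArrangement V}
    (c : IntersectionLattice A → Face A) : IntersectionLattice A → FaceAlgebra k A :=
  (wellFounded_gt (α := IntersectionLattice A)).fix fun X e =>
    MonoidAlgebra.single (c X) 1 -
      ∑ Y : {Y : IntersectionLattice A // X < Y}, MonoidAlgebra.single (c X) 1 * e Y.1 Y.2

open Classical in
theorem idem_eq (k : Type*) [Field k] {A : CentralArrangement V}
    (c : IntersectionLattice A → Face A) (X : IntersectionLattice A) :
    idem k c X = MonoidAlgebra.single (c X) 1 -
      ∑ Y : {Y : IntersectionLattice A // X < Y},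
        MonoidAlgebra.single (c X) 1 * idem k c Y.1 :=
  WellFounded.fix_eq _ _ _

/-- The quiver of `kF`: the Hasse diagram of `L`, with an arrow `X ⟶ Y` if `X` covers `Y`. -/
abbrev FaceQuiver (A : CentralArrangement V) : Type _ := HasseQuiver (IntersectionLattice A)

/-- `φ : kQ → kF` maps every vertex `X` to `e_X` and every arrow `X ⟶ Y` to `e_Y ∂(y) e_X`, where
`y = c Y` is the face chosen for `Y`. -/
def IsQuiverMap {k : Type*} [Field k] {A : CentralArrangement V} [FiniteDimensional ℝ V]
    (ε : Orientations A) (c : IntersectionLattice A → Face A)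
    (φ : PathAlgebra k (FaceQuiver A) →ₐ[k] FaceAlgebra k A) : Prop :=
  (∀ X : IntersectionLattice A, φ (PathAlgebra.vertex k (HasseQuiver.of X)) = idem k c X) ∧
    ∀ (X Y : IntersectionLattice A) (h : Y ⋖ X),
      φ (PathAlgebra.arrow k (HasseQuiver.arrow h)) =
        idem k c Y * boundary k ε (c Y) * idem k c X

/-- The set `R` of the sums of all paths of length two from `X` to `Z`, one for every interval
`[Z, X]` of length two in `L`. -/
def quiverRelations (k : Type*) [Field k] (A : CentralArrangement V) :
    Set (PathAlgebra k (FaceQuiver A)) :=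
  {r | ∃ Z X : IntersectionLattice A, IntervalLengthTwo Z X ∧ r = sumPathsTwo k Z X}

end CentralArrangement

/-! ### Faces, supports and covers in the intersection lattice -/

namespace CentralArrangement

variable {V : Type*} [AddCommGroup V] [Module ℝ V] {A : CentralArrangement V}

/-! The algebra is understood through right multiplication on itself. The elements `w * e_{supp w}`,
one for each face `w`, form a basis of `kF` (`theta_surjective`, `theta_injective`). In this basis
right multiplication by `e_X` is the projection to the faces of support `X`, and right
multiplication by `e_Y ∂(y) e_X` sends a function `m` on the faces of support `Y` to the function `x
↦ ∑ [w : x] m w` on the faces of support `X` (`theta_mul_arrow`). So the arrows act as the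
components of a cellular boundary operator, and the theorem reduces to the behaviour of this complex
in its lowest degrees.

The boundary squares to zero: between `w` and `x` two ranks apart there are exactly two faces, and
they contribute opposite signs (`inc_mul_inc_add`, `sum_inc_mul_inc`). Hence the sums of paths of
length two die (`map_sumPathsTwo`). The faces of a given support are connected through their walls
(`eq_of_forall_wall`). Hence, by induction on the support, all `x * e_X` are in the image and `φ` is
surjective (`quiverMap_surjective`).

The complex is exact in degree one (`exists_boundary`). Hence the relations generate the kernel
(`mul_vertex_mem_span`): an element of the kernel starting at `X` is `r • X + ∑ b_Y (X → Y)`. The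
augmentation gives `r = 0`, so the `φ(b_Y)` form a cycle, which is the boundary of some `n`. Lifting
`n` along `φ` and subtracting a multiple of the relations leaves elements of the kernel that start
at smaller vertices.

Exactness is proved dually, for cochains on convex regions cut out by sign conditions
(`exists_primitive`): cut the region along a hyperplane, take primitives on both sides, and correct
their jump across the cut by a constant. Admissibility and minimality only compare path lengths and
endpoints. -/

theorem form_eq_zero_iff (H : A.hyperplanes) (v : V) : A.form H v = 0 ↔ v ∈ H.1 := by
  rw [← LinearMap.mem_ker, A.ker_form]

/-- The face that contains a given vector. -/
noncomputable def faceOf (A : CentralArrangement V) (v : V) : Face A :=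
  ⟨fun H => SignType.sign (A.form H v), v, fun _ => rfl⟩

theorem faceOf_sign (v : V) (H : A.hyperplanes) :
    (A.faceOf v).sign H = SignType.sign (A.form H v) := rfl

namespace Face

/-- A vector in a face. -/
noncomputable def pt (x : Face A) : V := x.nonempty.choose

theorem sign_pt (x : Face A) (H : A.hyperplanes) : SignType.sign (A.form H x.pt) = x.sign H :=
  x.nonempty.choose_spec H

theorem pt_mem_supp (x : Face A) : x.pt ∈ x.supp := mem_supp_of_mem_carrier x.sign_pt

theorem form_pt_eq_zero {x : Face A} {H : A.hyperplanes} : A.form H x.pt = 0 ↔ x.sign H = 0 := by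
  rw [← x.sign_pt, sign_eq_zero_iff]

theorem supp_le_iff_sign {x : Face A} {H : A.hyperplanes} : x.supp ≤ H.1 ↔ x.sign H = 0 := by
  constructor
  · intro h
    rw [← form_pt_eq_zero, form_eq_zero_iff]
    exact h x.pt_mem_supp
  · intro h
    exact iInf_le (fun H : {H : A.hyperplanes // x.sign H = 0} => H.1.1) ⟨H, h⟩

theorem le_supp_iff {x : Face A} {U : Submodule ℝ V} :
    U ≤ x.supp ↔ ∀ H, x.sign H = 0 → U ≤ H.1 := by
  simp [supp, le_iInf_iff]

theorem supp_le_supp_iff {x y : Face A} :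
    x.supp ≤ y.supp ↔ ∀ H, y.sign H = 0 → x.sign H = 0 := by
  rw [le_supp_iff]
  simp only [supp_le_iff_sign]

theorem support_le_iff {x y : Face A} :
    x.support ≤ y.support ↔ ∀ H, y.sign H = 0 → x.sign H = 0 := supp_le_supp_iff

theorem support_eq_iff {x y : Face A} :
    x.support = y.support ↔ ∀ H, x.sign H = 0 ↔ y.sign H = 0 := by
  rw [le_antisymm_iff, support_le_iff, support_le_iff]
  exact ⟨fun h H => ⟨h.2 H, h.1 H⟩, fun h => ⟨fun H => (h H).2, fun H => (h H).1⟩⟩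

theorem support_coe (x : Face A) : (x.support : Submodule ℝ V) = x.supp := rfl

theorem support_mono {x y : Face A} (h : x ≤ y) : x.support ≤ y.support := supp_mono h

theorem mul_sign_eq_zero {x y : Face A} {H : A.hyperplanes} :
    (x * y).sign H = 0 ↔ x.sign H = 0 ∧ y.sign H = 0 := by
  rw [mul_sign]
  split_ifs with h <;> simp [h]

theorem le_mul (x y : Face A) : x ≤ x * y := by
  intro H
  rw [mul_sign]
  split_ifs with h
  · exact Or.inl h
  · exact Or.inr rfl

theorem mul_eq_left_of_support_le {x y : Face A} (h : y.support ≤ x.support) : x * y = x := by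
  ext H
  rw [mul_sign]
  split_ifs with h'
  · rw [h', support_le_iff.1 h H h']
  · rfl

theorem support_mul_le_iff {x y : Face A} {X : IntersectionLattice A} :
    (x * y).support ≤ X ↔ x.support ≤ X ∧ y.support ≤ X := by
  obtain ⟨_, z, rfl⟩ := X
  change (x * y).support ≤ z.support ↔ x.support ≤ z.support ∧ y.support ≤ z.support
  simp only [support_le_iff, mul_sign_eq_zero]
  exact ⟨fun h => ⟨fun H hH => (h H hH).1, fun H hH => (h H hH).2⟩,
    fun h H hH => ⟨h.1 H hH, h.2 H hH⟩⟩

theorem support_mul_comm (x y : Face A) : (x * y).support = (y * x).support := by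
  rw [support_eq_iff]
  simp only [mul_sign_eq_zero, and_comm, implies_true]

theorem support_mul {x y : Face A} (h : x.support ≤ y.support) :
    (x * y).support = y.support := by
  rw [support_mul_comm, mul_eq_left_of_support_le h]

/-- The opposite face. -/
def opp (x : Face A) : Face A :=
  ⟨fun H => - x.sign H, by
    obtain ⟨v, hv⟩ := x.nonempty
    exact ⟨-v, fun H => by rw [map_neg, Left.sign_neg, hv]⟩⟩

theorem opp_sign (x : Face A) (H : A.hyperplanes) : x.opp.sign H = - x.sign H := rfl

theorem support_opp (x : Face A) : x.opp.support = x.support := by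
  rw [support_eq_iff]
  intro H
  rw [opp_sign]
  cases x.sign H <;> decide

theorem eq_of_le_of_support_eq {x y : Face A} (h : x ≤ y) (hs : x.support = y.support) :
    x = y := by
  ext H
  rcases h H with h' | h'
  · rw [h', (support_eq_iff.1 hs H).1 h']
  · exact h'

theorem covBy_of_support {x y : Face A} (h : x ≤ y) (hs : x.support ⋖ y.support) : x ⋖ y := by
  refine ⟨lt_of_le_of_ne h (fun e => hs.lt.ne (by rw [e])), fun z hxz hzy => ?_⟩
  have h1 : x.support < z.support :=
    lt_of_le_of_ne (support_mono hxz.le) fun e => hxz.ne (eq_of_le_of_support_eq hxz.le e)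
  have h2 : z.support < y.support :=
    lt_of_le_of_ne (support_mono hzy.le) fun e => hzy.ne (eq_of_le_of_support_eq hzy.le e)
  exact hs.2 h1 h2

end Face

open Face

theorem faceOf_le_of_mem {U : Submodule ℝ V} {v : V} (hv : v ∈ U) {H : A.hyperplanes}
    (h : U ≤ H.1) : (A.faceOf v).sign H = 0 := by
  rw [faceOf_sign, sign_eq_zero_iff, form_eq_zero_iff]
  exact h hv

theorem mem_supp_iff {x : Face A} {v : V} :
    v ∈ x.supp ↔ ∀ H, x.sign H = 0 → A.form H v = 0 := by
  have := le_supp_iff (x := x) (U := Submodule.span ℝ {v})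
  simpa [form_eq_zero_iff] using this

/-- The lattice is closed under intersection with a hyperplane. -/
theorem exists_supp_eq_inf (X : IntersectionLattice A) (H : A.hyperplanes) :
    ∃ Y : IntersectionLattice A, (Y : Submodule ℝ V) = X.1 ⊓ H.1 := by
  classical
  obtain ⟨_, x, rfl⟩ := X
  simp only
  -- A real vector space is not a finite union of proper subspaces, so `X ⊓ H` has a vector outside
  -- every hyperplane of the arrangement that does not contain `X ⊓ H`. The face of such a vector
  -- has support `X ⊓ H`.
  obtain ⟨v, hv, hf⟩ := Module.Dual.exists_forall_mem_ne_zero_of_forall_exists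
    (K := ℝ) (x.supp ⊓ H.1)
    (fun K : {K : A.hyperplanes // ¬ x.supp ⊓ H.1 ≤ K.1} => A.form K.1) (by
      rintro ⟨K, hK⟩
      obtain ⟨v, hv, hvK⟩ := SetLike.not_le_iff_exists.1 hK
      exact ⟨v, hv, fun h => hvK ((form_eq_zero_iff K v).1 h)⟩)
  refine ⟨(A.faceOf v).support, le_antisymm ?_ ?_⟩
  · refine le_inf (fun w hw => ?_) (supp_le_iff_sign.2 (faceOf_le_of_mem hv inf_le_right))
    rw [mem_supp_iff]
    intro K hK
    have := supp_le_iff_sign.2 (faceOf_le_of_mem hv (inf_le_left.trans (supp_le_iff_sign.2 hK)))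
    rw [form_eq_zero_iff]
    exact this hw
  · change _ ≤ (A.faceOf v).supp
    rw [le_supp_iff]
    intro K hK
    by_contra h
    rw [faceOf_sign, sign_eq_zero_iff] at hK
    exact hf ⟨K, h⟩ hK

theorem exists_hyperplane_of_lt {Y X : IntersectionLattice A} (h : Y < X) :
    ∃ H : A.hyperplanes, Y.1 ≤ H.1 ∧ ¬ X.1 ≤ H.1 := by
  obtain ⟨_, y, rfl⟩ := Y
  have h' : ¬ X.1 ≤ y.supp := fun h' => h.not_ge h'
  rw [le_supp_iff] at h'
  push Not at h'
  obtain ⟨H, h1, h2⟩ := h'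
  exact ⟨H, supp_le_iff_sign.2 h1, h2⟩

/-- The subspace `X ⊓ H` belongs to the lattice, contains `Y` and is strictly below `X`, so it has
to be `Y`. Every cover is therefore a hyperplane section, and the dimension is a rank function. -/
theorem CovBy.eq_inf {Y X : IntersectionLattice A} (h : Y ⋖ X) {H : A.hyperplanes}
    (hY : Y.1 ≤ H.1) (hX : ¬ X.1 ≤ H.1) : Y.1 = X.1 ⊓ H.1 := by
  obtain ⟨W, hW⟩ := exists_supp_eq_inf X H
  have h1 : Y ≤ W := by
    change Y.1 ≤ W.1
    rw [hW]
    exact le_inf h.le hY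
  have h2 : W < X := by
    refine lt_of_le_of_ne (by change W.1 ≤ X.1; rw [hW]; exact inf_le_left) ?_
    rintro rfl
    exact hX (by rw [hW]; exact inf_le_right)
  rcases h1.eq_or_lt with e | e
  · rw [e, hW]
  · exact absurd h2 (h.2 e)

theorem finrank_eq_of_eq_inf [FiniteDimensional ℝ V] {Y X : Submodule ℝ V} {H : A.hyperplanes}
    (hX : ¬ X ≤ H.1) (h : Y = X ⊓ H.1) : Module.finrank ℝ X = Module.finrank ℝ Y + 1 := by
  have hker : LinearMap.ker ((A.form H).comp X.subtype) = Submodule.comap X.subtype Y := by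
    ext v
    simp [h, form_eq_zero_iff]
  have hne : (A.form H).comp X.subtype ≠ 0 := by
    intro h0
    apply hX
    intro v hv
    rw [← form_eq_zero_iff]
    exact DFunLike.congr_fun h0 (⟨v, hv⟩ : X)
  have h1 := LinearMap.finrank_range_add_finrank_ker ((A.form H).comp X.subtype)
  rw [LinearMap.range_eq_top.2 (LinearMap.surjective hne), hker, finrank_top,
    Module.finrank_self] at h1
  have h2 : Module.finrank ℝ (Submodule.comap X.subtype Y) = Module.finrank ℝ Y :=
    (Submodule.comapSubtypeEquivOfLe (by rw [h]; exact inf_le_left)).finrank_eq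
  omega

theorem CovBy.finrank [FiniteDimensional ℝ V] {Y X : IntersectionLattice A} (h : Y ⋖ X) :
    Module.finrank ℝ X.1 = Module.finrank ℝ Y.1 + 1 := by
  obtain ⟨H, h1, h2⟩ := exists_hyperplane_of_lt h.lt
  exact finrank_eq_of_eq_inf h2 (CovBy.eq_inf h h1 h2)

theorem finrank_lt_of_lt [FiniteDimensional ℝ V] {Y X : IntersectionLattice A} (h : Y < X) :
    Module.finrank ℝ Y.1 < Module.finrank ℝ X.1 := Submodule.finrank_lt_finrank_of_lt h

theorem covBy_of_eq_inf {Y X : IntersectionLattice A} {H : A.hyperplanes}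
    (hX : ¬ X.1 ≤ H.1) (h : Y.1 = X.1 ⊓ H.1) : Y ⋖ X := by
  have hYX : Y < X := by
    refine lt_of_le_of_ne (by change Y.1 ≤ X.1; rw [h]; exact inf_le_left) ?_
    rintro rfl
    exact hX (by rw [h]; exact inf_le_right)
  refine ⟨hYX, fun Z hYZ hZX => ?_⟩
  have hZH : ¬ Z.1 ≤ H.1 := fun hZ => hYZ.not_ge (by
    change Z.1 ≤ Y.1; rw [h]; exact le_inf hZX.le hZ)
  obtain ⟨v, hv, hvH⟩ := SetLike.not_le_iff_exists.1 hZH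
  rw [← form_eq_zero_iff] at hvH
  apply hZX.not_ge
  intro w hw
  -- Projecting along `v ∈ Z \ H` moves any `w ∈ X` into `X ⊓ H = Y`, so `X ≤ Y + ℝ v ≤ Z`.
  have : w - (A.form H w / A.form H v) • v ∈ Y.1 := by
    rw [h]
    refine ⟨X.1.sub_mem hw (X.1.smul_mem _ (hZX.le hv)), ?_⟩
    change _ ∈ H.1
    rw [← form_eq_zero_iff]
    simp [hvH]
  have h2 := Z.1.add_mem (hYZ.le this) (Z.1.smul_mem (A.form H w / A.form H v) hv)
  simpa using h2

/-! ### The two faces above a face of codimension one -/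

theorem sign_eq_of_le_of_not_le {w x : Face A} (h : w ≤ x) {H : A.hyperplanes}
    (hH : ¬ w.supp ≤ H.1) : x.sign H = w.sign H := by
  rw [supp_le_iff_sign] at hH
  exact ((h H).resolve_left hH).symm

/-- Forms of hyperplanes with the same trace on `X` are proportional on `X`. -/
theorem form_mul_form_eq {Y X : Submodule ℝ V} {H K : A.hyperplanes} (hH : Y = X ⊓ H.1)
    (hK : Y ≤ K.1) {v v' : V} (hv : v ∈ X) (hv' : v' ∈ X) :
    A.form H v * A.form K v' = A.form H v' * A.form K v := by
  have : A.form H v • v' - A.form H v' • v ∈ Y := by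
    rw [hH]
    refine ⟨X.sub_mem (X.smul_mem _ hv') (X.smul_mem _ hv), ?_⟩
    change _ ∈ H.1
    rw [← form_eq_zero_iff]
    simp [mul_comm]
  have h2 := (form_eq_zero_iff K _).2 (hK this)
  simpa [sub_eq_zero] using h2

/-- The forms of all hyperplanes through `w` are proportional to that of `H` on the common support,
so the sign at `H` determines the signs at these. At the other hyperplanes both faces inherit the
sign of `w`. -/
theorem eq_of_sign_eq {w x x' : Face A} (hx : w ≤ x) (hx' : w ≤ x')
    (hs : x.support = x'.support) {H : A.hyperplanes} (hcov : w.supp = x.supp ⊓ H.1)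
    (hH : x.sign H = x'.sign H) : x = x' := by
  ext K
  by_cases hK : w.supp ≤ K.1
  · have hpt : x'.pt ∈ x.supp := by
      rw [← support_coe, hs]
      exact x'.pt_mem_supp
    have h1 := form_mul_form_eq hcov hK x.pt_mem_supp hpt
    have h2 := congrArg SignType.sign h1
    rw [sign_mul, sign_mul, sign_pt, sign_pt, sign_pt, sign_pt, ← hH] at h2
    -- In the degenerate case `x` has the support of `w`, and both faces equal `w`.
    by_cases h0 : x.sign H = 0
    · have : x.support = w.support := by
        apply le_antisymm _ (support_mono hx)
        change x.supp ≤ w.supp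
        rw [hcov]
        exact le_inf le_rfl (supp_le_iff_sign.2 h0)
      have h3 := eq_of_le_of_support_eq hx this.symm
      have h4 := eq_of_le_of_support_eq hx' (this.symm.trans hs)
      rw [← h3, ← h4]
    · clear hH
      generalize x.sign H = a at *
      generalize x.sign K = b at *
      generalize x'.sign K = c at *
      revert a b c
      decide
  · rw [sign_eq_of_le_of_not_le hx hK, sign_eq_of_le_of_not_le hx' hK]

/-- The face opposite to `x` with respect to `w`. -/
def flip (w x : Face A) : Face A := w * x.opp

theorem le_flip (w x : Face A) : w ≤ flip w x := le_mul _ _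

theorem support_flip {w x : Face A} (h : w ≤ x) : (flip w x).support = x.support := by
  rw [flip, support_mul] <;> rw [support_opp]
  exact support_mono h

theorem flip_sign {w x : Face A} {H : A.hyperplanes} (hH : w.supp ≤ H.1) :
    (flip w x).sign H = - x.sign H := by
  rw [flip, mul_sign, if_pos (supp_le_iff_sign.1 hH), opp_sign]

theorem flip_ne {w x : Face A} {H : A.hyperplanes} (hH : w.supp ≤ H.1)
    (hX : ¬ x.supp ≤ H.1) : flip w x ≠ x := by
  intro h
  have h1 := flip_sign (x := x) hH
  rw [h] at h1
  apply hX
  rw [supp_le_iff_sign]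
  generalize x.sign H = a at *
  revert a
  decide

/-- A face above `w` of the given support is determined by its sign at one hyperplane, and only two
nonzero signs are available. Together with `flip_ne` this shows that a wall has exactly two sides.
-/
theorem eq_or_eq_flip {w x x' : Face A} (hx : w ≤ x) (hx' : w ≤ x')
    (hs : x'.support = x.support) (hc : w.support ⋖ x.support) : x' = x ∨ x' = flip w x := by
  obtain ⟨H, h1, h2⟩ := exists_hyperplane_of_lt hc.lt
  have hcov := CovBy.eq_inf hc h1 h2
  have e1 : x.sign H ≠ 0 := fun h => h2 (supp_le_iff_sign.2 h)
  have e2 : x'.sign H ≠ 0 := fun h => e1 ((support_eq_iff.1 hs H).1 h)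
  by_cases h : x.sign H = x'.sign H
  · exact Or.inl (eq_of_sign_eq hx hx' hs.symm hcov h).symm
  · right
    refine (eq_of_sign_eq (le_flip w x) hx' ?_ (H := H) ?_ ?_).symm
    · rw [support_flip hx, hs]
    · rw [← support_coe (flip w x), support_flip hx]; exact hcov
    · rw [flip_sign h1]
      generalize x.sign H = a at *
      generalize x'.sign H = b at *
      revert a b
      decide

theorem not_mem_of_covBy {Y X : IntersectionLattice A} (h : Y ⋖ X) {x : Face A}
    (hx : x.support = X) : x.pt ∉ Y.1 := by
  subst hx
  obtain ⟨H, h1, h2⟩ := exists_hyperplane_of_lt h.lt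
  intro hY
  apply h2
  rw [support_coe, supp_le_iff_sign, ← form_pt_eq_zero, form_eq_zero_iff]
  exact h1 hY

theorem exists_support_above {w : Face A} {X : IntersectionLattice A} (h : w.support ≤ X) :
    ∃ x, w ≤ x ∧ x.support = X := by
  obtain ⟨_, x, rfl⟩ := X
  exact ⟨w * x, le_mul _ _, support_mul h⟩

theorem support_le_of_sign_eq_zero {w : Face A} {X : IntersectionLattice A} (h : w.support ≤ X)
    {Y : IntersectionLattice A} {H : A.hyperplanes} (hYX : Y.1 = X.1 ⊓ H.1)
    (hw : w.sign H = 0) : w.support ≤ Y := by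
  change w.supp ≤ Y.1
  rw [hYX]
  exact le_inf h (supp_le_iff_sign.2 hw)

theorem eq_one_or_eq_neg_one {a : SignType} (h : a ≠ 0) : a = 1 ∨ a = -1 := by
  revert a
  decide

end CentralArrangement

/-! ### Alternating forms and incidence numbers -/

/-- Evaluation of an alternating form at a fixed last argument. -/
noncomputable def AlternatingMap.evalLast {V : Type*} [AddCommGroup V] [Module ℝ V] {m n : ℕ}
    (F : V [⋀^Fin m]→ₗ[ℝ] ℝ) (h : m = n + 1) : V →ₗ[ℝ] V [⋀^Fin n]→ₗ[ℝ] ℝ :=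
  (F.domDomCongr ((finCongr h).trans (finRotate (n + 1)))).curryLeft

/-- The rotation turns the last slot into the first, the one that `curryLeft` fills. The equation `m
= n + 1` is a hypothesis because the dimensions to which this is applied are successors only
propositionally. -/
theorem AlternatingMap.evalLast_apply {V : Type*} [AddCommGroup V] [Module ℝ V] {m n : ℕ}
    (F : V [⋀^Fin m]→ₗ[ℝ] ℝ) (h : m = n + 1) (v : V) (u : Fin n → V) :
    F.evalLast h v u = F fun j => if hj : (j : ℕ) < n then u ⟨j, hj⟩ else v := by
  subst h
  simp only [evalLast, AlternatingMap.curryLeft_apply_apply, AlternatingMap.domDomCongr_apply]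
  congr 1
  ext j
  split_ifs with hj
  · have : finRotate (n + 1) j = Fin.succ ⟨j, hj⟩ := by
      have := finRotate_of_lt hj
      simpa using this
    simp [this]
  · have : j = Fin.last n := by
      ext
      simp only [Fin.val_last]
      omega
    subst this
    simp

theorem AlternatingMap.evalLast_self {V : Type*} [AddCommGroup V] [Module ℝ V] {m n l : ℕ}
    (F : V [⋀^Fin m]→ₗ[ℝ] ℝ) (h : m = n + 1) (h' : n = l + 1) (v : V) :
    (F.evalLast h v).evalLast h' v = 0 := by
  ext u
  rw [evalLast_apply, evalLast_apply]
  refine F.map_eq_zero_of_eq _ (i := ⟨n, by omega⟩) (j := ⟨l, by omega⟩) ?_ ?_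
  · simp [h']
  · simp [h']

/-- Alternating forms of top degree on `Y` form a line, so a change of basis multiplies all of them
by the same determinant. This is why incidence numbers do not depend on the basis. -/
theorem AlternatingMap.apply_eq_mul_det {V : Type*} [AddCommGroup V] [Module ℝ V] {n : ℕ}
    {Y : Submodule ℝ V} (G : V [⋀^Fin n]→ₗ[ℝ] ℝ) (b : Module.Basis (Fin n) ℝ Y)
    (u : Fin n → Y) : (G fun i => (u i : V)) = (G fun i => (b i : V)) * b.det u := by
  have := AlternatingMap.eq_smul_basis_det b (G.compLinearMap Y.subtype)
  have h2 := DFunLike.congr_fun this u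
  simpa using h2

namespace CentralArrangement

variable {V : Type*} [AddCommGroup V] [Module ℝ V] {A : CentralArrangement V}

open Face

section

variable (ε : Orientations A)

/-- A volume form on the ambient space whose restriction to `X` represents the orientation. -/
noncomputable def vol (X : IntersectionLattice A) :
    V [⋀^Fin (Module.finrank ℝ X.1)]→ₗ[ℝ] ℝ :=
  (ε X).someVector.compLinearMap (X.1.subtype.exists_leftInverse_of_injective
    X.1.ker_subtype).choose

/-- Pulling the form back along a retraction of `V` onto `X` changes nothing on `X`, and allows
forms of different subspaces to be evaluated at the same vectors. -/
theorem vol_apply (X : IntersectionLattice A) (u : Fin (Module.finrank ℝ X.1) → X.1) :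
    (vol ε X fun i => (u i : V)) = (ε X).someVector u := by
  have h := (X.1.subtype.exists_leftInverse_of_injective X.1.ker_subtype).choose_spec
  rw [vol, AlternatingMap.compLinearMap_apply]
  congr 1
  ext i
  exact congrArg _ (DFunLike.congr_fun h (u i))

variable [FiniteDimensional ℝ V]

/-- The chosen basis of `X`, as vectors of the ambient space. -/
noncomputable def basisVec (X : IntersectionLattice A) (i : Fin (Module.finrank ℝ X.1)) : V :=
  Module.finBasis ℝ X.1 i

theorem vol_basisVec_ne_zero (X : IntersectionLattice A) : vol ε X (basisVec X) ≠ 0 := by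
  have := vol_apply ε X (Module.finBasis ℝ X.1)
  unfold basisVec
  rw [this]
  exact ((ε X).someVector.map_basis_ne_zero_iff _).2 (ε X).someVector_ne_zero

/-- The linear form that vanishes on `Y` and defines the incidence numbers between faces of
supports `Y` and `X`. -/
noncomputable def incForm {Y X : IntersectionLattice A} (h : Y ⋖ X) : V →ₗ[ℝ] ℝ where
  toFun v := vol ε Y (basisVec Y) * (vol ε X).evalLast (CovBy.finrank h) v (basisVec Y)
  map_add' v w := by simp [mul_add]
  map_smul' r v := by simp; ring

theorem incForm_apply {Y X : IntersectionLattice A} (h : Y ⋖ X) (v : V) : incForm ε h v =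
    vol ε Y (basisVec Y) * (vol ε X).evalLast (CovBy.finrank h) v (basisVec Y) := rfl

theorem incForm_eq_zero {Y X : IntersectionLattice A} (h : Y ⋖ X) {v : V} (hv : v ∈ Y.1) :
    incForm ε h v = 0 := by
  rw [incForm_apply, AlternatingMap.evalLast, AlternatingMap.curryLeft_apply_apply]
  refine mul_eq_zero_of_right _ (AlternatingMap.map_linearDependent _ _ ?_)
  intro hli
  refine (linearIndependent_finCons.1 hli).2 ?_
  have h1 : Set.range (basisVec Y) = Y.1.subtype '' Set.range (Module.finBasis ℝ Y.1) := by
    rw [← Set.range_comp]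
    rfl
  rw [h1, Submodule.span_image, Module.Basis.span_eq]
  simpa using hv

/-- A vector of `X` outside `Y` completes a basis of `Y` to one of `X`, and a nonzero form of top
degree does not vanish at a basis. With `incForm_eq_zero`, the kernel of the incidence form on `X`
is `Y`. -/
theorem incForm_ne_zero {Y X : IntersectionLattice A} (h : Y ⋖ X) {v : V} (hv : v ∈ X.1)
    (hvY : v ∉ Y.1) : incForm ε h v ≠ 0 := by
  rw [incForm_apply]
  refine mul_ne_zero (vol_basisVec_ne_zero ε Y) ?_
  rw [AlternatingMap.evalLast, AlternatingMap.curryLeft_apply_apply]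
  have hb : ∀ i, basisVec Y i ∈ X.1 := fun i => h.le (Module.finBasis ℝ Y.1 i).2
  set u : Fin (Module.finrank ℝ Y.1 + 1) → X.1 :=
    Fin.cons ⟨v, hv⟩ fun i => ⟨basisVec Y i, hb i⟩ with hu
  have hli : LinearIndependent ℝ u := by
    rw [hu, linearIndependent_finCons]
    constructor
    · refine LinearIndependent.of_comp X.1.subtype ?_
      exact (Module.finBasis ℝ Y.1).linearIndependent.map' Y.1.subtype Y.1.ker_subtype
    · intro hmem
      apply hvY
      have := Submodule.mem_map_of_mem (f := X.1.subtype) hmem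
      rw [← Submodule.span_image, ← Set.range_comp] at this
      refine (Submodule.span_le (p := Y.1)).2 ?_ this
      rintro _ ⟨i, rfl⟩
      exact (Module.finBasis ℝ Y.1 i).2
  let b := basisOfLinearIndependentOfCardEqFinrank hli (by simp [CovBy.finrank h])
  set σ := (finCongr (CovBy.finrank h)).trans (finRotate (Module.finrank ℝ Y.1 + 1))
  have h1 : (fun i => ((b.reindex σ.symm) i : V)) = fun i => (u (σ i) : V) := by
    ext i
    simp [b]
  have h2 := vol_apply ε X (b.reindex σ.symm)
  rw [h1] at h2
  have h3 : (Matrix.vecCons v (basisVec Y) : Fin (Module.finrank ℝ Y.1 + 1) → V) =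
      fun i => (u i : V) := by
    ext i
    refine Fin.cases ?_ (fun i => ?_) i <;> simp [hu]
  rw [h3, AlternatingMap.domDomCongr_apply]
  refine ne_of_eq_of_ne h2 ?_
  exact ((ε X).someVector.map_basis_ne_zero_iff _).2 (ε X).someVector_ne_zero

/-- The definition of `incidence` makes the same choices of basis and vector as `basisVec` and `pt`;
only the passage from the supports to `V` has to be checked. -/
theorem incidence_eq {x y : Face A} (h : x ⋖ y) (hs : x.support ⋖ y.support) :
    incidence ε h = SignType.sign (incForm ε hs y.pt) := by
  rw [incForm_apply, sign_mul, AlternatingMap.evalLast_apply]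
  unfold incidence orientationSign
  dsimp only
  congr 2
  · exact (vol_apply ε x.support (Module.finBasis ℝ x.supp)).symm
  · refine (vol_apply ε y.support _).symm.trans ?_
    congr 1
    ext j
    by_cases hj : (j : ℕ) < Module.finrank ℝ x.supp
    · refine (congrArg Subtype.val (dif_pos hj)).trans (Eq.trans ?_ (dif_pos hj).symm)
      rfl
    · refine (congrArg Subtype.val (dif_neg hj)).trans (Eq.trans ?_ (dif_neg hj).symm)
      rfl

/-- The incidence form can be computed with any basis of `Y`. -/
theorem sign_incForm {Y X : IntersectionLattice A} (h : Y ⋖ X) (v : V)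
    (u : Fin (Module.finrank ℝ Y.1) → Y.1) (hu : (vol ε Y fun i => (u i : V)) ≠ 0) :
    SignType.sign (incForm ε h v) = SignType.sign ((vol ε Y fun i => (u i : V)) *
      (vol ε X).evalLast (CovBy.finrank h) v fun i => (u i : V)) := by
  rw [AlternatingMap.apply_eq_mul_det _ (Module.finBasis ℝ Y.1) u] at hu ⊢
  rw [AlternatingMap.apply_eq_mul_det ((vol ε X).evalLast (CovBy.finrank h) v)
    (Module.finBasis ℝ Y.1) u, incForm_apply]
  have hd := right_ne_zero_of_mul hu
  -- Both factors change by the same determinant `d`, which enters as a positive square.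
  have e : ∀ a b d : ℝ, a * d * (b * d) = a * b * (d * d) := fun a b d => by ring
  rw [e, sign_mul (_ * _) (_ * _), sign_pos (mul_self_pos.2 hd), mul_one]
  rfl

/-- The alternating form that gives the products of incidence numbers along `Z ⋖ Y ⋖ X`. -/
noncomputable def incForm₂ {Z X : IntersectionLattice A}
    (h : Module.finrank ℝ X.1 = Module.finrank ℝ Z.1 + 1 + 1) (p v : V) : ℝ :=
  vol ε Z (basisVec Z) * ((vol ε X).evalLast h v).evalLast rfl p (basisVec Z)

theorem incForm₂_self {Z X : IntersectionLattice A}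
    (h : Module.finrank ℝ X.1 = Module.finrank ℝ Z.1 + 1 + 1) (p : V) :
    incForm₂ ε h p p = 0 := by
  rw [incForm₂, AlternatingMap.evalLast_self]
  simp

theorem incForm₂_add_right {Z X : IntersectionLattice A}
    (h : Module.finrank ℝ X.1 = Module.finrank ℝ Z.1 + 1 + 1) (p v w : V) :
    incForm₂ ε h p (v + w) = incForm₂ ε h p v + incForm₂ ε h p w := by
  simp only [incForm₂, AlternatingMap.evalLast_apply, map_add, AlternatingMap.add_apply, mul_add]

theorem incForm₂_smul_right {Z X : IntersectionLattice A}
    (h : Module.finrank ℝ X.1 = Module.finrank ℝ Z.1 + 1 + 1) (r : ℝ) (p v : V) :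
    incForm₂ ε h p (r • v) = r * incForm₂ ε h p v := by
  simp only [incForm₂, AlternatingMap.evalLast_apply, map_smul, AlternatingMap.smul_apply,
    smul_eq_mul]
  ring

theorem incForm₂_add_left {Z X : IntersectionLattice A}
    (h : Module.finrank ℝ X.1 = Module.finrank ℝ Z.1 + 1 + 1) (p q v : V) :
    incForm₂ ε h (p + q) v = incForm₂ ε h p v + incForm₂ ε h q v := by
  simp only [incForm₂, map_add, AlternatingMap.add_apply, mul_add]

theorem incForm₂_swap {Z X : IntersectionLattice A}
    (h : Module.finrank ℝ X.1 = Module.finrank ℝ Z.1 + 1 + 1) (p v : V) :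
    incForm₂ ε h p v = - incForm₂ ε h v p := by
  have := incForm₂_self ε h (p + v)
  rw [incForm₂_add_right, incForm₂_add_left, incForm₂_add_left, incForm₂_self,
    incForm₂_self] at this
  linarith

/-- Compute the second incidence number in the basis of `Y` that consists of the basis of `Z`
followed by `p`. The value of the volume form of `Y` at this basis then occurs in both factors,
hence as a square, and only the orientations of `Z` and `X` remain. -/
theorem sign_incForm_mul {Z Y X : IntersectionLattice A} (hZY : Z ⋖ Y) (hYX : Y ⋖ X)
    (h : Module.finrank ℝ X.1 = Module.finrank ℝ Z.1 + 1 + 1) {p v : V} (hp : p ∈ Y.1)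
    (hpZ : p ∉ Z.1) :
    SignType.sign (incForm ε hZY p) * SignType.sign (incForm ε hYX v) =
      SignType.sign (incForm₂ ε h p v) := by
  have hn := CovBy.finrank hZY
  let u : Fin (Module.finrank ℝ Y.1) → Y.1 := fun j =>
    if hj : (j : ℕ) < Module.finrank ℝ Z.1 then
      ⟨basisVec Z ⟨j, hj⟩, hZY.le (Module.finBasis ℝ Z.1 ⟨j, hj⟩).2⟩ else ⟨p, hp⟩
  have hu : (fun j => (u j : V)) = fun j : Fin (Module.finrank ℝ Y.1) =>
      if hj : (j : ℕ) < Module.finrank ℝ Z.1 then basisVec Z ⟨j, hj⟩ else p := by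
    ext j
    simp only [u]
    split_ifs <;> rfl
  have e1 : incForm ε hZY p = vol ε Z (basisVec Z) * vol ε Y fun j => (u j : V) := by
    rw [incForm_apply, AlternatingMap.evalLast_apply, hu]
  have hne := incForm_ne_zero ε hZY hp hpZ
  rw [e1] at hne
  rw [sign_incForm ε hYX v u (right_ne_zero_of_mul hne), e1, ← sign_mul]
  have e2 : ((vol ε X).evalLast (CovBy.finrank hYX) v fun j => (u j : V)) =
      ((vol ε X).evalLast h v).evalLast rfl p (basisVec Z) := by
    rw [AlternatingMap.evalLast_apply, AlternatingMap.evalLast_apply,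
      AlternatingMap.evalLast_apply]
    congr 1
    ext j
    simp only [fun i => congrFun hu i]
    by_cases hj : (j : ℕ) < Module.finrank ℝ Z.1
    · have h1 : (j : ℕ) < Module.finrank ℝ Y.1 := by omega
      have h2 : (j : ℕ) < Module.finrank ℝ Z.1 + 1 := by omega
      simp [hj, h1, h2]
    · by_cases hj' : (j : ℕ) < Module.finrank ℝ Y.1
      · have h2 : (j : ℕ) < Module.finrank ℝ Z.1 + 1 := by omega
        simp [hj, hj', h2]
      · have h2 : ¬ (j : ℕ) < Module.finrank ℝ Z.1 + 1 := by omega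
        simp [hj', h2]
  rw [e2, incForm₂]
  have e : ∀ a b c : ℝ, a * b * (b * c) = (a * c) * (b * b) := fun a b c => by ring
  rw [e, sign_mul (_ * _) (_ * _), sign_pos (mul_self_pos.2 (right_ne_zero_of_mul hne)), mul_one]

/-! ### Incidence numbers of pairs of faces -/

open Classical in
/-- The incidence number of two faces, zero unless `w ≤ x` and the support of `x` covers the
support of `w`. -/
noncomputable def inc (w x : Face A) : SignType :=
  if h : w ≤ x ∧ w.support ⋖ x.support then incidence ε (covBy_of_support h.1 h.2) else 0

variable {ε}

theorem inc_eq_zero {w x : Face A} (h : ¬ (w ≤ x ∧ w.support ⋖ x.support)) :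
    inc ε w x = 0 := dif_neg h

theorem of_inc_ne_zero {w x : Face A} (h : inc ε w x ≠ 0) :
    w ≤ x ∧ w.support ⋖ x.support := by
  by_contra h'
  exact h (inc_eq_zero h')

theorem inc_eq {Y X : IntersectionLattice A} (h : Y ⋖ X) {w x : Face A} (hwx : w ≤ x)
    (hw : w.support = Y) (hx : x.support = X) :
    inc ε w x = SignType.sign (incForm ε h x.pt) := by
  subst hw hx
  rw [inc, dif_pos ⟨hwx, h⟩, incidence_eq _ _ h]

theorem inc_ne_zero {w x : Face A} (h : w.support ⋖ x.support) (hwx : w ≤ x) :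
    inc ε w x ≠ 0 := by
  rw [inc_eq h hwx rfl rfl, sign_ne_zero]
  exact incForm_ne_zero ε h x.pt_mem_supp (not_mem_of_covBy h rfl)

theorem incForm_mul_form {Y X : IntersectionLattice A} (h : Y ⋖ X) {H : A.hyperplanes}
    (hH : Y.1 = X.1 ⊓ H.1) {v v' : V} (hv : v ∈ X.1) (hv' : v' ∈ X.1) :
    A.form H v * incForm ε h v' = A.form H v' * incForm ε h v := by
  have : A.form H v • v' - A.form H v' • v ∈ Y.1 := by
    rw [hH]
    refine ⟨X.1.sub_mem (X.1.smul_mem _ hv') (X.1.smul_mem _ hv), ?_⟩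
    change _ ∈ H.1
    rw [← form_eq_zero_iff]
    simp [mul_comm]
  have h2 := incForm_eq_zero ε h this
  simpa [sub_eq_zero] using h2

theorem sign_mul_inc {Y X : IntersectionLattice A} (h : Y ⋖ X) {H : A.hyperplanes}
    (hH : Y.1 ≤ H.1) (hX : ¬ X.1 ≤ H.1) {w x : Face A} (hwx : w ≤ x) (hw : w.support = Y)
    (hx : x.support = X) {v : V} (hv : v ∈ X.1) :
    SignType.sign (A.form H v) * inc ε w x = x.sign H * SignType.sign (incForm ε h v) := by
  have hpt : x.pt ∈ X.1 := by rw [← hx]; exact x.pt_mem_supp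
  rw [inc_eq h hwx hw hx, ← sign_pt, ← sign_mul, ← sign_mul,
    incForm_mul_form h (CovBy.eq_inf h hH hX) hv hpt]

/-- The incidence form and the form of `H` are proportional on `X`, since both vanish on `Y`. So the
ratio of the incidence number to the sign at `H` depends only on `Y ⋖ X`, not on the faces. -/
theorem inc_mul_sign {Y X : IntersectionLattice A} (h : Y ⋖ X) {H : A.hyperplanes}
    (hH : Y.1 ≤ H.1) (hX : ¬ X.1 ≤ H.1) {w x w' x' : Face A} (hwx : w ≤ x)
    (hw : w.support = Y) (hx : x.support = X) (hwx' : w' ≤ x') (hw' : w'.support = Y)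
    (hx' : x'.support = X) : x'.sign H * inc ε w x = x.sign H * inc ε w' x' := by
  have hpt : x'.pt ∈ X.1 := by rw [← hx']; exact x'.pt_mem_supp
  rw [inc_eq h hwx' hw' hx', ← sign_mul_inc h hH hX hwx hw hx hpt, sign_pt]

theorem inc_flip {w x : Face A} (hwx : w ≤ x) :
    inc ε w (flip w x) = - inc ε w x := by
  by_cases hc : w.support ⋖ x.support
  · obtain ⟨H, h1, h2⟩ := exists_hyperplane_of_lt hc.lt
    have := inc_mul_sign (ε := ε) hc h1 h2 hwx rfl rfl (le_flip w x) rfl (support_flip hwx)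
    rw [flip_sign h1] at this
    have h3 : x.sign H ≠ 0 := fun h => h2 (supp_le_iff_sign.2 h)
    generalize x.sign H = a at *
    generalize inc ε w x = b at *
    generalize inc ε w (flip w x) = c at *
    revert a b c
    decide
  · rw [inc_eq_zero (x := x) (by tauto), inc_eq_zero (x := flip w x)
      (by rw [support_flip hwx]; tauto)]
    rfl

/-- The sum over the two faces above a face of codimension one. -/
theorem sum_inc_smul {k M : Type*} [Field k] [AddCommGroup M] [Module k M] {w x : Face A} (hwx : w ≤ x)
    (hc : w.support ⋖ x.support) (g : Face A → M) [DecidableEq (IntersectionLattice A)] :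
    ∑ x' with x'.support = x.support, ((inc ε w x' : SignType) : k) • g x' =
      ((inc ε w x : SignType) : k) • (g x - g (flip w x)) := by
  classical
  obtain ⟨H, h1, h2⟩ := exists_hyperplane_of_lt hc.lt
  rw [← Finset.sum_subset (s₁ := {x, flip w x})]
  · rw [Finset.sum_pair (flip_ne h1 h2).symm, inc_flip hwx]
    rw [SignType.coe_neg, neg_smul, smul_sub, sub_eq_add_neg]
  · intro y hy
    simp only [Finset.mem_insert, Finset.mem_singleton] at hy
    rcases hy with rfl | rfl <;> simp [support_flip hwx]
  · intro y hy hy'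
    simp only [Finset.mem_filter, Finset.mem_univ, true_and] at hy
    rw [inc_eq_zero, SignType.coe_zero, zero_smul]
    rintro ⟨h3, -⟩
    rcases eq_or_eq_flip hwx h3 hy hc with rfl | rfl <;> simp at hy'

theorem sum_inc_mul {k : Type*} [Field k] {w x : Face A} (hwx : w ≤ x)
    (hc : w.support ⋖ x.support) (g : Face A → k) [DecidableEq (IntersectionLattice A)] :
    ∑ x' with x'.support = x.support, ((inc ε w x' : SignType) : k) * g x' =
      ((inc ε w x : SignType) : k) * (g x - g (flip w x)) :=
  sum_inc_smul (k := k) (ε := ε) hwx hc g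

end

end CentralArrangement

namespace CentralArrangement

variable {V : Type*} [AddCommGroup V] [Module ℝ V] {A : CentralArrangement V}

open Face

/-! ### The composite of two boundary maps -/

theorem div_pos_of_sign_eq {r s : ℝ} (h : SignType.sign r = SignType.sign s) (hs : s ≠ 0) :
    0 < r / s := by
  rcases lt_or_gt_of_ne hs with h' | h'
  · rw [sign_neg h', sign_eq_neg_one_iff] at h
    exact div_pos_of_neg_of_neg h h'
  · rw [sign_pos h', sign_eq_one_iff] at h
    exact div_pos h h'

theorem sign_eq_of_le {y x : Face A} (h : y ≤ x) {H : A.hyperplanes} (hH : y.sign H ≠ 0) :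
    y.sign H = x.sign H := (h H).resolve_left hH

theorem covBy_of_finrank [FiniteDimensional ℝ V] {Y X : IntersectionLattice A} (h : Y < X)
    (hr : Module.finrank ℝ X.1 = Module.finrank ℝ Y.1 + 1) : Y ⋖ X := by
  refine ⟨h, fun Z h1 h2 => ?_⟩
  have := finrank_lt_of_lt h1
  have := finrank_lt_of_lt h2
  omega

/-- Walk from a point of `x` in the direction opposite to `y` until the first hyperplane `K` that
contains `w` but not `y` is reached, at the point `q`. Hyperplanes containing `y` keep the sign of
`x` along the way, and those not containing `w` are taken care of by multiplying with `w`. The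
second face is thus `w * A.faceOf q`. -/
theorem exists_ne_between [FiniteDimensional ℝ V] {w y x : Face A} (hwy : w ≤ y) (hyx : y ≤ x)
    (h1 : w.support ⋖ y.support) (h2 : y.support ⋖ x.support) :
    ∃ y', y' ≠ y ∧ w ≤ y' ∧ y' ≤ x ∧ w.support ⋖ y'.support ∧ y'.support ⋖ x.support := by
  classical
  obtain ⟨H₀, hY0, hX0⟩ := exists_hyperplane_of_lt h2.lt
  obtain ⟨H₁, hZ1, hY1⟩ := exists_hyperplane_of_lt h1.lt
  rw [support_coe, supp_le_iff_sign] at hY0 hX0 hZ1 hY1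
  let t : A.hyperplanes → ℝ := fun H => A.form H x.pt / A.form H y.pt
  obtain ⟨K, hK, hmin⟩ := Finset.exists_min_image
    (Finset.univ.filter fun H : A.hyperplanes => w.sign H = 0 ∧ y.sign H ≠ 0) t
    ⟨H₁, by simp [hZ1, hY1]⟩
  simp only [Finset.mem_filter, Finset.mem_univ, true_and] at hK hmin
  set q := x.pt - t K • y.pt with hq
  have hform : ∀ H, A.form H q = A.form H x.pt - t K * A.form H y.pt := by
    intro H
    simp [hq]
  have hform' : ∀ H, y.sign H ≠ 0 → A.form H q = (t H - t K) * A.form H y.pt := by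
    intro H hH
    replace hH := form_pt_eq_zero.not.2 hH
    rw [hform, sub_mul, div_mul_cancel₀ _ hH]
  have hle : w * A.faceOf q ≤ x := by
    intro H
    rw [mul_sign]
    split_ifs with h
    · rw [faceOf_sign]
      by_cases hy : y.sign H = 0
      · right
        rw [hform, form_pt_eq_zero.2 hy, mul_zero, sub_zero, sign_pt]
      · rw [hform' H hy, sign_mul, sign_pt]
        rcases (hmin H ⟨h, hy⟩).eq_or_lt with e | e
        · left
          simp [e]
        · right
          rw [sign_pos (sub_pos.2 e), one_mul, sign_eq_of_le hyx hy]
    · exact Or.inr (sign_eq_of_le (hwy.trans hyx) h)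
  have hwH₀ : w.sign H₀ = 0 := (hwy H₀).elim id fun h => h.trans hY0
  have hs0 : (w * A.faceOf q).sign H₀ ≠ 0 := by
    rw [mul_sign, if_pos hwH₀, faceOf_sign, hform, form_pt_eq_zero.2 hY0, mul_zero, sub_zero,
      sign_pt]
    exact hX0
  have hsK : (w * A.faceOf q).sign K = 0 := by
    rw [mul_sign, if_pos hK.1, faceOf_sign, hform' K hK.2, sub_self, zero_mul, sign_zero]
  have hxK : x.sign K ≠ 0 := by
    rw [← sign_eq_of_le hyx hK.2]
    exact hK.2
  have l1 : w.support < (w * A.faceOf q).support := by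
    refine lt_of_le_of_ne (support_mono (le_mul _ _)) fun e => hs0 ?_
    exact (support_eq_iff.1 e H₀).1 hwH₀
  have l2 : (w * A.faceOf q).support < x.support := by
    refine lt_of_le_of_ne (support_mono hle) fun e => hxK ?_
    exact (support_eq_iff.1 e K).1 hsK
  -- The dimensions at the two ends differ by two, so the strict inclusions `l1` and `l2` are
  -- already covers.
  have f1 := CovBy.finrank h1
  have f2 := CovBy.finrank h2
  have f3 := finrank_lt_of_lt l1
  have f4 := finrank_lt_of_lt l2
  refine ⟨w * A.faceOf q, ?_, le_mul _ _, hle, covBy_of_finrank l1 (by omega),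
    covBy_of_finrank l2 (by omega)⟩
  intro e
  rw [e] at hs0
  exact hs0 hY0

/-- Both faces inherit the sign of `x` at a hyperplane that separates their support from that of
`w`. Walls of `x` at `w` can thus be told apart by their supports. -/
theorem eq_of_support_eq_between {w y y' x : Face A} (hwy : w ≤ y) (hyx : y ≤ x)
    (hwy' : w ≤ y') (hyx' : y' ≤ x) (h1 : w.support ⋖ y.support)
    (hs : y.support = y'.support) : y = y' := by
  obtain ⟨H, h2, h3⟩ := exists_hyperplane_of_lt h1.lt
  have hy : y.sign H ≠ 0 := fun h => h3 (supp_le_iff_sign.2 h)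
  have hy' : y'.sign H ≠ 0 := fun h => hy ((support_eq_iff.1 hs H).2 h)
  exact eq_of_sign_eq hwy hwy' hs (CovBy.eq_inf h1 h2 h3)
    ((sign_eq_of_le hyx hy).trans (sign_eq_of_le hyx' hy').symm)

theorem CovBy.eq_of_le {P : Type*} [PartialOrder P] {a b c : P} (h : a ⋖ c) (h' : b ⋖ c)
    (hab : a ≤ b) : a = b := by
  rcases hab.eq_or_lt with e | e
  · exact e
  · exact absurd h'.lt (h.2 e)

/-- A face `y` of `x` above `w` that lies on neither of the two walls `y₀`, `y₁` of `x` at `w`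
has its points in the open cone spanned by them. -/
theorem exists_pt_eq {w y₀ y₁ y x : Face A} (hw₀ : w ≤ y₀) (hw₁ : w ≤ y₁) (h₀ : y₀ ≤ x)
    (h₁ : y₁ ≤ x) (hy : y ≤ x) (c₀ : w.support ⋖ y₀.support) (d₀ : y₀.support ⋖ x.support)
    (d₁ : y₁.support ⋖ x.support) (hne : y₀ ≠ y₁)
    (hy₀ : ¬ y.support ≤ y₀.support) (hy₁ : ¬ y.support ≤ y₁.support) :
    ∃ a b : ℝ, 0 < a ∧ 0 < b ∧ ∃ z ∈ w.supp, y.pt = a • y₀.pt + b • y₁.pt + z := by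
  obtain ⟨H₀, e₀, f₀⟩ := exists_hyperplane_of_lt d₀.lt
  obtain ⟨H₁, e₁, f₁⟩ := exists_hyperplane_of_lt d₁.lt
  have i₀ := CovBy.eq_inf d₀ e₀ f₀
  have i₁ := CovBy.eq_inf d₁ e₁ f₁
  have key : ∀ y : Face A, y ≤ x → ∀ {Y : IntersectionLattice A} {H : A.hyperplanes},
      Y.1 = x.support.1 ⊓ H.1 → ¬ y.support ≤ Y → A.form H y.pt ≠ 0 := by
    intro y hy Y H hY hn h0
    apply hn
    change y.supp ≤ Y.1
    rw [hY]
    exact le_inf (supp_mono hy) (supp_le_iff_sign.2 (form_pt_eq_zero.1 h0))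
  have hne' : y₀.support ≠ y₁.support := fun h =>
    hne (eq_of_support_eq_between hw₀ h₀ hw₁ h₁ c₀ h)
  have n₀ : A.form H₁ y₀.pt ≠ 0 := key y₀ h₀ i₁ fun h => hne' (CovBy.eq_of_le d₀ d₁ h)
  have n₁ : A.form H₀ y₁.pt ≠ 0 := key y₁ h₁ i₀ fun h => hne' (CovBy.eq_of_le d₁ d₀ h).symm
  have m₀ := key y hy i₀ hy₀
  have m₁ := key y hy i₁ hy₁
  have sgn : ∀ {y y' : Face A} {H : A.hyperplanes}, y ≤ x → y' ≤ x → A.form H y.pt ≠ 0 →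
      A.form H y'.pt ≠ 0 → 0 < A.form H y.pt / A.form H y'.pt := by
    intro y y' H hy hy' h h'
    refine div_pos_of_sign_eq ?_ h'
    rw [sign_pt, sign_pt, sign_eq_of_le hy (form_pt_eq_zero.not.1 h),
      sign_eq_of_le hy' (form_pt_eq_zero.not.1 h')]
  have z₀ : A.form H₀ y₀.pt = 0 := form_pt_eq_zero.2 (supp_le_iff_sign.1 e₀)
  have z₁ : A.form H₁ y₁.pt = 0 := form_pt_eq_zero.2 (supp_le_iff_sign.1 e₁)
  -- `H₀` vanishes on `y₀` and `H₁` on `y₁`, so these ratios are the coefficients for which the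
  -- remainder vanishes on both. The remainder then lies in `supp x ⊓ H₀ ⊓ H₁ = supp w`.
  refine ⟨_, _, sgn hy h₀ m₁ n₀, sgn hy h₁ m₀ n₁,
    y.pt - (A.form H₁ y.pt / A.form H₁ y₀.pt) • y₀.pt -
      (A.form H₀ y.pt / A.form H₀ y₁.pt) • y₁.pt, ?_, by abel⟩
  have hw1 : w.support.1 ≤ H₁.1 := (supp_mono hw₁).trans e₁
  have iw : w.support.1 = y₀.support.1 ⊓ H₁.1 := CovBy.eq_inf c₀ hw1 fun h =>
    n₀ (form_pt_eq_zero.2 (supp_le_iff_sign.1 h))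
  rw [← support_coe, iw, i₀]
  refine ⟨⟨?_, ?_⟩, ?_⟩
  · exact sub_mem (sub_mem (supp_mono hy y.pt_mem_supp)
      (Submodule.smul_mem _ _ (supp_mono h₀ y₀.pt_mem_supp)))
      (Submodule.smul_mem _ _ (supp_mono h₁ y₁.pt_mem_supp))
  · change _ ∈ H₀.1
    rw [← form_eq_zero_iff]
    simp [z₀, div_mul_cancel₀ _ n₁]
  · change _ ∈ H₁.1
    rw [← form_eq_zero_iff]
    simp [z₁, div_mul_cancel₀ _ n₀]

/-- A third wall `y` would be a positive combination of `y₀` and `y₁` modulo `supp w`. Take `H`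
containing `y` but not `x`. At `H` the two faces have the sign of `x` or sign zero, so the positive
combination can vanish only if both do; but `x` is also a combination of them modulo `supp w`, and
would lie in `H`. -/
theorem eq_or_eq_of_between {w y₀ y₁ y x : Face A} (hw₀ : w ≤ y₀) (hw₁ : w ≤ y₁)
    (h₀ : y₀ ≤ x) (h₁ : y₁ ≤ x) (hw : w ≤ y) (hy : y ≤ x) (c₀ : w.support ⋖ y₀.support)
    (c₁ : w.support ⋖ y₁.support) (d₀ : y₀.support ⋖ x.support)
    (d₁ : y₁.support ⋖ x.support) (d : y.support ⋖ x.support)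
    (hne : y₀ ≠ y₁) : y = y₀ ∨ y = y₁ := by
  by_contra! hcon
  have hy₀ : ¬ y.support ≤ y₀.support := fun h => hcon.1
    (eq_of_support_eq_between hw₀ h₀ hw hy c₀ (CovBy.eq_of_le d d₀ h).symm).symm
  have hy₁ : ¬ y.support ≤ y₁.support := fun h => hcon.2
    (eq_of_support_eq_between hw₁ h₁ hw hy c₁ (CovBy.eq_of_le d d₁ h).symm).symm
  obtain ⟨a, b, ha, hb, z, hz, e⟩ := exists_pt_eq hw₀ hw₁ h₀ h₁ hy c₀ d₀ d₁ hne hy₀ hy₁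
  obtain ⟨a', b', -, -, z', hz', e'⟩ := exists_pt_eq hw₀ hw₁ h₀ h₁ le_rfl c₀ d₀ d₁ hne
    d₀.lt.not_ge d₁.lt.not_ge
  obtain ⟨H, hY, hX⟩ := exists_hyperplane_of_lt d.lt
  have hzH : ∀ z ∈ w.supp, A.form H z = 0 := fun z hz =>
    (form_eq_zero_iff H z).2 (hY (supp_mono hw hz))
  rw [support_coe, supp_le_iff_sign] at hY hX
  have e2 := congrArg (A.form H) e
  have e3 := congrArg (A.form H) e'
  simp only [map_add, map_smul, smul_eq_mul, hzH z hz, hzH z' hz', form_pt_eq_zero.2 hY] at e2 e3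
  have s₀ := sign_pt y₀ H
  have s₁ := sign_pt y₁ H
  rw [← form_pt_eq_zero] at hX
  have both : A.form H y₀.pt = 0 ∧ A.form H y₁.pt = 0 := by
    rcases h₀ H with k₀ | k₀
    · rw [k₀, sign_eq_zero_iff] at s₀
      refine ⟨s₀, ?_⟩
      rw [s₀, mul_zero, zero_add, add_zero] at e2
      exact (mul_eq_zero.1 e2.symm).resolve_left hb.ne'
    · rcases h₁ H with k₁ | k₁
      · rw [k₁, sign_eq_zero_iff] at s₁
        refine ⟨?_, s₁⟩
        rw [s₁, mul_zero, add_zero, add_zero] at e2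
        exact (mul_eq_zero.1 e2.symm).resolve_left ha.ne'
      · exfalso
        rw [k₀, ← sign_pt] at s₀
        rw [k₁, ← sign_pt] at s₁
        have := mul_pos ha (div_pos_of_sign_eq s₀ hX)
        have := mul_pos hb (div_pos_of_sign_eq s₁ hX)
        have e4 : a * (A.form H y₀.pt / A.form H x.pt) + b * (A.form H y₁.pt / A.form H x.pt)
            = 0 := by
          have : (a * A.form H y₀.pt + b * A.form H y₁.pt) / A.form H x.pt = 0 := by
            rw [add_zero] at e2
            rw [← e2, zero_div]
          rw [← this]
          ring
        linarith
  rw [both.1, both.2] at e3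
  simp at e3
  exact hX e3

variable {ε : Orientations A}

/-- Write `x = a y₀ + b y₁ + z` with `a, b > 0` and `z ∈ supp w`. The two products are the signs of
`ω(y₀, x) = b ω(y₀, y₁)` and `ω(y₁, x) = a ω(y₁, y₀)`, where `ω` is the alternating form `incForm₂`.
-/
theorem inc_mul_inc_add [FiniteDimensional ℝ V] {w y₀ y₁ x : Face A} (hw₀ : w ≤ y₀)
    (hw₁ : w ≤ y₁) (h₀ : y₀ ≤ x) (h₁ : y₁ ≤ x) (c₀ : w.support ⋖ y₀.support)
    (c₁ : w.support ⋖ y₁.support) (d₀ : y₀.support ⋖ x.support)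
    (d₁ : y₁.support ⋖ x.support) (hne : y₀ ≠ y₁) :
    inc ε w y₁ * inc ε y₁ x = - (inc ε w y₀ * inc ε y₀ x) := by
  obtain ⟨a, b, ha, hb, z, hz, e⟩ := exists_pt_eq hw₀ hw₁ h₀ h₁ le_rfl c₀ d₀ d₁ hne
    d₀.lt.not_ge d₁.lt.not_ge
  have hn : Module.finrank ℝ x.support.1 = Module.finrank ℝ w.support.1 + 1 + 1 := by
    rw [CovBy.finrank d₀, CovBy.finrank c₀]
  have key : ∀ y : Face A, ∀ c : w.support ⋖ y.support, ∀ d : y.support ⋖ x.support,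
      w ≤ y → y ≤ x → inc ε w y * inc ε y x = SignType.sign (incForm₂ ε hn y.pt x.pt) ∧
        incForm₂ ε hn y.pt z = 0 := by
    intro y c d hw h
    have hp : y.pt ∉ w.support.1 := not_mem_of_covBy c rfl
    refine ⟨?_, ?_⟩
    · rw [inc_eq c hw rfl rfl, inc_eq d h rfl rfl]
      exact sign_incForm_mul ε c d hn y.pt_mem_supp hp
    · rw [← sign_eq_zero_iff, ← sign_incForm_mul ε c d hn y.pt_mem_supp hp,
        incForm_eq_zero ε d (supp_mono hw hz), sign_zero, mul_zero]
  obtain ⟨k₀, l₀⟩ := key y₀ c₀ d₀ hw₀ h₀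
  obtain ⟨k₁, l₁⟩ := key y₁ c₁ d₁ hw₁ h₁
  rw [k₀, k₁, e]
  simp only [incForm₂_add_right, incForm₂_smul_right, incForm₂_self, l₀, l₁, mul_zero, add_zero,
    zero_add]
  rw [incForm₂_swap ε hn y₁.pt, sign_mul, sign_mul, sign_pos ha, sign_pos hb, Left.sign_neg,
    one_mul, one_mul]

/-- The boundary squares to zero: either no term is nonzero, or exactly the two faces of the diamond
contribute, with opposite signs. -/
theorem sum_inc_mul_inc [FiniteDimensional ℝ V] (k : Type*) [Field k] (w x : Face A) :
    ∑ y, ((inc ε w y : SignType) : k) * ((inc ε y x : SignType) : k) = 0 := by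
  classical
  by_cases h : ∃ y, w ≤ y ∧ y ≤ x ∧ w.support ⋖ y.support ∧ y.support ⋖ x.support
  · obtain ⟨y₀, hw₀, h₀, c₀, d₀⟩ := h
    obtain ⟨y₁, hne, hw₁, h₁, c₁, d₁⟩ := exists_ne_between hw₀ h₀ c₀ d₀
    rw [← Finset.sum_subset (Finset.subset_univ {y₀, y₁}), Finset.sum_pair hne.symm]
    · have := congrArg (fun s : SignType => (s : k))
        (inc_mul_inc_add (ε := ε) hw₀ hw₁ h₀ h₁ c₀ c₁ d₀ d₁ hne.symm)
      simp only [SignType.coe_mul, SignType.coe_neg] at this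
      rw [this]
      ring
    · intro y _ hy
      by_contra hcon
      have n1 : inc ε w y ≠ 0 := fun h => hcon (by simp [h])
      have n2 : inc ε y x ≠ 0 := fun h => hcon (by simp [h])
      obtain ⟨a1, a2⟩ := of_inc_ne_zero n1
      obtain ⟨b1, b2⟩ := of_inc_ne_zero n2
      apply hy
      rcases eq_or_eq_of_between hw₀ hw₁ h₀ h₁ a1 b1 c₀ c₁ d₀ d₁ b2 hne.symm with rfl | rfl <;>
        simp
  · refine Finset.sum_eq_zero fun y _ => ?_
    by_contra hcon
    have n1 : inc ε w y ≠ 0 := fun h => hcon (by simp [h])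
    have n2 : inc ε y x ≠ 0 := fun h => hcon (by simp [h])
    obtain ⟨a1, a2⟩ := of_inc_ne_zero n1
    obtain ⟨b1, b2⟩ := of_inc_ne_zero n2
    exact h ⟨y, a1, b1, a2, b2⟩

/-! ### Exactness over convex regions -/

/-- The face lies in the region in which the signs are prescribed by `s`, wherever `s` is not
zero. -/
def InRegion (s : A.hyperplanes → SignType) (w : Face A) : Prop :=
  ∀ H, s H = 0 ∨ w.sign H = s H

theorem InRegion.mono {s : A.hyperplanes → SignType} {w x : Face A} (hw : InRegion s w)
    (h : w ≤ x) : InRegion s x := by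
  intro H
  rcases hw H with h1 | h1
  · exact Or.inl h1
  · rcases h H with h2 | h2
    · exact Or.inl (h1.symm.trans h2)
    · exact Or.inr (h2.symm.trans h1)

open Classical in
theorem inRegion_update {s : A.hyperplanes → SignType} {H : A.hyperplanes} (hs : s H = 0)
    {e : SignType} (he : e ≠ 0) {w : Face A} :
    InRegion (Function.update s H e) w ↔ InRegion s w ∧ w.sign H = e := by
  constructor
  · intro h
    refine ⟨fun K => ?_, ?_⟩
    · by_cases hK : K = H
      · subst hK
        exact Or.inl hs
      · simpa [hK] using h K
    · simpa [he] using h H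
  · rintro ⟨h1, h2⟩ K
    by_cases hK : K = H
    · subst hK
      simp [h2]
    · simpa [hK] using h1 K

open Classical in
-- The number of hyperplanes without a prescribed sign is the measure for the inductions over
-- regions; cutting by a hyperplane lowers it.
theorem card_zeros_update_lt {s : A.hyperplanes → SignType} {H : A.hyperplanes} (hs : s H = 0)
    {e : SignType} (he : e ≠ 0) :
    (Finset.univ.filter fun K => Function.update s H e K = 0).card <
      (Finset.univ.filter fun K => s K = 0).card := by
  apply Finset.card_lt_card
  refine ⟨fun K hK => ?_, fun h => ?_⟩
  · simp only [Finset.mem_filter, Finset.mem_univ, true_and] at hK ⊢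
    by_cases e1 : K = H
    · subst e1
      exact hs
    · simpa [e1] using hK
  · have := h (show H ∈ _ by simp [hs])
    simp [he] at this

theorem exists_separating {s : A.hyperplanes → SignType} {x x' : Face A}
    (hx : InRegion s x) (hx' : InRegion s x') (hs : x.support = x'.support) (hne : x ≠ x') :
    ∃ H, s H = 0 ∧ ((x.sign H = 1 ∧ x'.sign H = -1) ∨ (x'.sign H = 1 ∧ x.sign H = -1)) := by
  have : ∃ H, x.sign H ≠ x'.sign H := by
    by_contra! h
    exact hne (Face.ext (funext h))
  obtain ⟨H, hH⟩ := this
  refine ⟨H, ?_, ?_⟩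
  · rcases hx H with h | h
    · exact h
    · exact (hx' H).resolve_right fun h' => hH (h.trans h'.symm)
  · have := support_eq_iff.1 hs H
    generalize x.sign H = a at *
    generalize x'.sign H = b at *
    revert a b
    decide

/-- Between two faces of the same support on different sides of `H` there is a wall in `H`. -/
theorem exists_wall {s : A.hyperplanes → SignType} {x x' : Face A} (hx : InRegion s x)
    (hx' : InRegion s x') {X : IntersectionLattice A} (hX : x.support = X)
    (hX' : x'.support = X) {H : A.hyperplanes} (h1 : x.sign H = 1) (h2 : x'.sign H = -1) :
    ∃ w, InRegion s w ∧ w.sign H = 0 ∧ w.support ⋖ X ∧ w.supp = X.1 ⊓ H.1 := by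
  obtain ⟨⟨_, y, rfl⟩, hY⟩ := exists_supp_eq_inf X H
  simp only at hY
  have p1 : 0 < A.form H x.pt := by
    rw [← sign_eq_one_iff, sign_pt, h1]
  have p2 : 0 < - A.form H x'.pt := by
    rw [neg_pos, ← sign_eq_neg_one_iff, sign_pt, h2]
  -- Up to a positive factor, the point where the segment between the two faces meets `H`. As a
  -- positive combination it stays in the convex region.
  set p := (- A.form H x'.pt) • x.pt + A.form H x.pt • x'.pt with hp
  have hpX : p ∈ X.1 := by
    refine add_mem (Submodule.smul_mem _ _ ?_) (Submodule.smul_mem _ _ ?_)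
    · rw [← hX]; exact x.pt_mem_supp
    · rw [← hX']; exact x'.pt_mem_supp
  have hpH : p ∈ H.1 := by
    rw [← form_eq_zero_iff]
    simp [hp]
    ring
  have hle : (A.faceOf p).support ≤ y.support := by
    rw [support_le_iff]
    intro K hK
    rw [← supp_le_iff_sign, hY] at hK
    exact faceOf_le_of_mem (U := X.1 ⊓ H.1) ⟨hpX, hpH⟩ hK
  -- The face of `p` may be too small; multiplying by a face `y` of support `X ⊓ H` enlarges it to
  -- that support without leaving the region.
  have hsupp : (A.faceOf p * y).support = y.support := support_mul hle
  have hsupp' : (A.faceOf p * y).supp = X.1 ⊓ H.1 := by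
    rw [← hY, ← support_coe, hsupp, support_coe]
  have hXH : ¬ X.1 ≤ H.1 := by
    rw [← hX, support_coe, supp_le_iff_sign, h1]
    decide
  refine ⟨A.faceOf p * y, ?_, ?_, covBy_of_eq_inf hXH hsupp', hsupp'⟩
  · refine InRegion.mono (w := A.faceOf p) (fun K => ?_) (le_mul _ _)
    by_cases hK : s K = 0
    · exact Or.inl hK
    · right
      have k1 := (hx K).resolve_left hK
      have k2 := (hx' K).resolve_left hK
      rw [faceOf_sign, hp, map_add, map_smul, map_smul, smul_eq_mul, smul_eq_mul]
      rw [← sign_pt] at k1 k2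
      rcases hsK : s K with _ | _ | _
      · exact absurd hsK hK
      · rw [hsK] at k1 k2
        have k1' := sign_eq_neg_one_iff.1 k1
        have k2' := sign_eq_neg_one_iff.1 k2
        exact sign_eq_neg_one_iff.2
          (add_neg (mul_neg_of_pos_of_neg p2 k1') (mul_neg_of_pos_of_neg p1 k2'))
      · rw [hsK] at k1 k2
        have k1' := sign_eq_one_iff.1 k1
        have k2' := sign_eq_one_iff.1 k2
        exact sign_eq_one_iff.2 (add_pos (mul_pos p2 k1') (mul_pos p1 k2'))
  · rw [← supp_le_iff_sign, hsupp']
    exact inf_le_right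

/-- The faces of a given support in a convex region are connected through their walls. -/
theorem eq_of_forall_wall {α : Type*} (X : IntersectionLattice A) (h : Face A → α)
    (s : A.hyperplanes → SignType)
    (hw : ∀ w, InRegion s w → w.support ⋖ X → ∀ x x', w ≤ x → w ≤ x' → x.support = X →
      x'.support = X → h x = h x')
    {x x' : Face A} (hx : InRegion s x) (hx' : InRegion s x') (hX : x.support = X)
    (hX' : x'.support = X) : h x = h x' := by
  classical
  induction hn : (Finset.univ.filter fun K => s K = 0).card using Nat.strong_induction_on
    generalizing s x x' with
  | _ n ih =>
  subst hn
  have main : ∀ {x x' : Face A}, InRegion s x → InRegion s x' → x.support = X →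
      x'.support = X → ∀ H, s H = 0 → x.sign H = 1 → x'.sign H = -1 → h x = h x' := by
    intro x x' hx hx' hX hX' H hs h1 h2
    obtain ⟨w, hws, hwH, hwX, -⟩ := exists_wall hx hx' hX hX' h1 h2
    -- On each side of `H` the region has fewer free hyperplanes, so there a face `y` is linked to
    -- `w * y` by induction. The faces `w * x` and `w * x'` on the two sides share the wall `w`.
    have sub : ∀ (e : SignType), e ≠ 0 → ∀ y : Face A, InRegion s y → y.support = X →
        y.sign H = e → h y = h (w * y) := by
      intro e he y hy hyX hye
      refine ih _ (card_zeros_update_lt hs he) (Function.update s H e) ?_ ?_ ?_ hyX ?_ rfl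
      · intro w' hw'
        exact hw w' ((inRegion_update hs he).1 hw').1
      · exact (inRegion_update hs he).2 ⟨hy, hye⟩
      · refine (inRegion_update hs he).2 ⟨hws.mono (le_mul _ _), ?_⟩
        rw [mul_sign, if_pos hwH, hye]
      · rw [support_mul, hyX]
        rw [hyX]
        exact hwX.le
    rw [sub 1 (by decide) x hx hX h1, sub (-1) (by decide) x' hx' hX' h2]
    refine hw w hws hwX _ _ (le_mul _ _) (le_mul _ _) ?_ ?_
    · rw [support_mul, hX]
      rw [hX]; exact hwX.le
    · rw [support_mul, hX']
      rw [hX']; exact hwX.le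
  by_cases hne : x = x'
  · rw [hne]
  · obtain ⟨H, hs, h1 | h1⟩ := exists_separating hx hx' (hX.trans hX'.symm) hne
    · exact main hx hx' hX hX' H hs h1.1 h1.2
    · exact (main hx' hx hX' hX H hs h1.1 h1.2).symm

end CentralArrangement

/-! ### Coboundaries and exactness in degree one -/

namespace CentralArrangement

variable {V : Type*} [AddCommGroup V] [Module ℝ V] [FiniteDimensional ℝ V]
  {A : CentralArrangement V} {k : Type*} [Field k] {ε : Orientations A}

open Face

open Classical in
/-- The coboundary of a function on the faces of support `X`. -/
noncomputable def cobd (ε : Orientations A) (X : IntersectionLattice A) (h : Face A → k)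
    (w : Face A) : k :=
  ∑ x with x.support = X, ((inc ε w x : SignType) : k) * h x

theorem cobd_eq {X : IntersectionLattice A} (h : Face A → k) {w x : Face A} (hwx : w ≤ x)
    (hx : x.support = X) (hc : w.support ⋖ X) :
    cobd ε X h w = ((inc ε w x : SignType) : k) * (h x - h (flip w x)) := by
  classical
  subst hx
  rw [← sum_inc_mul hwx hc h, cobd]

theorem coe_sign_mul_self {s : SignType} (h : s ≠ 0) : (s : k) * (s : k) = 1 := by
  cases s <;> simp_all

theorem coe_sign_ne_zero {s : SignType} (h : s ≠ 0) : (s : k) ≠ 0 := by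
  intro h0
  have := coe_sign_mul_self (k := k) h
  simp [h0] at this

theorem sum_inc_mul_cobd (X : IntersectionLattice A) (h : Face A → k) (z : Face A)
    [DecidablePred fun w : Face A => w.support ⋖ X] :
    ∑ w with w.support ⋖ X, ((inc ε z w : SignType) : k) * cobd ε X h w = 0 := by
  classical
  simp only [cobd, Finset.mul_sum]
  rw [Finset.sum_comm]
  refine Finset.sum_eq_zero fun x hx => ?_
  simp only [Finset.mem_filter, Finset.mem_univ, true_and] at hx
  have := sum_inc_mul_inc (ε := ε) k z x
  rw [← Finset.sum_subset (Finset.filter_subset (fun w : Face A => w.support ⋖ X) _)] at this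
  · simp only [← mul_assoc, ← Finset.sum_mul]
    rw [this, zero_mul]
  · intro w _ hw
    rw [inc_eq_zero (x := x), SignType.coe_zero, mul_zero]
    rintro ⟨-, h'⟩
    rw [hx] at h'
    simp [h'] at hw

open Classical in
/-- Exactness of the cellular complex of a convex region, in cohomological degree one: a function
on the walls whose coboundary vanishes is a coboundary. -/
theorem exists_primitive (X : IntersectionLattice A) (g : Face A → k)
    (s : A.hyperplanes → SignType)
    (hg : ∀ z, InRegion s z →
      ∑ w with w.support ⋖ X, ((inc ε z w : SignType) : k) * g w = 0) :
    ∃ h : Face A → k, ∀ w, InRegion s w → w.support ⋖ X → g w = cobd ε X h w := by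
  induction hn : (Finset.univ.filter fun K => s K = 0).card using Nat.strong_induction_on
    generalizing s with
  | _ n ih =>
  subst hn
  by_cases hall : ∀ x x' : Face A, InRegion s x → InRegion s x' → x.support = X →
      x'.support = X → x = x'
  -- A region with at most one face of support `X` contains no wall, because a wall has two sides,
  -- both in the region.
  · refine ⟨0, fun w hw hwX => ?_⟩
    exfalso
    obtain ⟨x, hwx, hx⟩ := exists_support_above hwX.le
    obtain ⟨H, h1, h2⟩ := exists_hyperplane_of_lt hwX.lt
    rw [← hx] at h2
    exact flip_ne h1 h2 (hall _ _ (hw.mono (le_flip w x)) (hw.mono hwx)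
      ((support_flip hwx).trans hx) hx)
  push Not at hall
  obtain ⟨x₀, x₁, hx₀, hx₁, hX₀, hX₁, hne⟩ := hall
  obtain ⟨H, hs, hH⟩ := exists_separating hx₀ hx₁ (hX₀.trans hX₁.symm) hne
  obtain ⟨w₀, hw₀s, hw₀H, hw₀X, hw₀⟩ :
      ∃ w, InRegion s w ∧ w.sign H = 0 ∧ w.support ⋖ X ∧ w.supp = X.1 ⊓ H.1 := by
    rcases hH with h | h
    · exact exists_wall hx₀ hx₁ hX₀ hX₁ h.1 h.2
    · exact exists_wall hx₁ hx₀ hX₁ hX₀ h.1 h.2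
  have hXH : ∀ x : Face A, x.support = X → x.sign H ≠ 0 := by
    intro x hx
    have : x₀.sign H ≠ 0 := by rcases hH with h | h <;> simp [h.1, h.2]
    exact fun h => this ((support_eq_iff.1 (hX₀.trans hx.symm) H).2 h)
  have part : ∀ e : SignType, e ≠ 0 → ∃ h : Face A → k, ∀ w, InRegion s w → w.sign H = e →
      w.support ⋖ X → g w = cobd ε X h w := by
    intro e he
    obtain ⟨h, hh⟩ := ih _ (card_zeros_update_lt hs he) (Function.update s H e)
      (fun z hz => hg z ((inRegion_update hs he).1 hz).1) rfl
    exact ⟨h, fun w h1 h2 h3 => hh w ((inRegion_update hs he).2 ⟨h1, h2⟩) h3⟩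
  obtain ⟨h₁, hh₁⟩ := part 1 (by decide)
  obtain ⟨h₂, hh₂⟩ := part (-1) (by decide)
  -- Glue the primitives of the two sides. At a wall not in `H` both adjacent faces lie on the same
  -- side, so the glued function is right there; the error `r` is confined to the walls in `H`.
  let h : Face A → k := fun x => if x.sign H = 1 then h₁ x else h₂ x
  have off : ∀ w, InRegion s w → w.support ⋖ X → w.sign H ≠ 0 → g w = cobd ε X h w := by
    intro w hws hwX hwH
    obtain ⟨x, hwx, hx⟩ := exists_support_above hwX.le
    have e1 : x.sign H = w.sign H := (sign_eq_of_le hwx hwH).symm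
    have e2 : (flip w x).sign H = w.sign H := (sign_eq_of_le (le_flip w x) hwH).symm
    rw [cobd_eq h hwx hx hwX]
    by_cases h1 : w.sign H = 1
    · rw [hh₁ w hws h1 hwX, cobd_eq h₁ hwx hx hwX]
      simp only [h, e1, e2, h1, if_true]
    · have h2 : w.sign H = -1 := (eq_one_or_eq_neg_one hwH).resolve_left h1
      rw [hh₂ w hws h2 hwX, cobd_eq h₂ hwx hx hwX]
      simp only [h, e1, e2, h1, if_false]
  let r : Face A → k := fun w => g w - cobd ε X h w
  have hr : ∀ z, InRegion s z →
      ∑ w with w.support ⋖ X, ((inc ε z w : SignType) : k) * r w = 0 := by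
    intro z hz
    simp only [r, mul_sub, Finset.sum_sub_distrib]
    rw [hg z hz, sum_inc_mul_cobd, sub_zero]
  -- The error is closed. At a face `z` of codimension one in the walls in `H`, the only nonzero
  -- terms come from the two walls in `H` above `z`, with opposite incidence numbers, so `r` agrees
  -- on them. Connectedness of the walls in `H` makes `r` constant.
  have hconst : ∀ w, InRegion s w → w.support = w₀.support → r w = r w₀ := by
    intro w hws hw
    refine eq_of_forall_wall w₀.support r s ?_ hws hw₀s hw rfl
    intro z hzs hz y y' hzy hzy' hy hy'
    rcases eq_or_eq_flip hzy hzy' (hy'.trans hy.symm) (by rw [hy]; exact hz) with e | e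
    · rw [e]
    have hz0 : z.support ⋖ y.support := by rw [hy]; exact hz
    have h0 := hr z hzs
    have h1 := sum_inc_mul (ε := ε) hzy hz0 r
    rw [hy] at h1
    have h2 : ∑ x' with x'.support = w₀.support, ((inc ε z x' : SignType) : k) * r x' =
        ∑ w with w.support ⋖ X, ((inc ε z w : SignType) : k) * r w := by
      refine Finset.sum_subset (fun w hw => ?_) (fun w hw hw' => ?_)
      · simp only [Finset.mem_filter, Finset.mem_univ, true_and] at hw ⊢
        rw [hw]
        exact hw₀X
      · simp only [Finset.mem_filter, Finset.mem_univ, true_and] at hw hw'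
        by_cases hzw : z ≤ w
        · have hwH : w.sign H ≠ 0 := fun h => hw' (CovBy.eq_of_le hw hw₀X
            (support_le_of_sign_eq_zero hw.le hw₀ h))
          rw [show r w = 0 from sub_eq_zero.2 (off w (hzs.mono hzw) hw hwH), mul_zero]
        · rw [inc_eq_zero fun h => hzw h.1, SignType.coe_zero, zero_mul]
    rw [h2, h0] at h1
    have h3 := (mul_eq_zero.1 h1.symm).resolve_left (coe_sign_ne_zero (inc_ne_zero hz0 hzy))
    rw [e]
    exact sub_eq_zero.1 h3
  have hw₀H' : w₀.support.1 ≤ H.1 := supp_le_iff_sign.2 hw₀H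
  have hXH' : ¬ X.1 ≤ H.1 := by
    rw [← hX₀, support_coe, supp_le_iff_sign]
    exact hXH x₀ hX₀
  obtain ⟨x₂, hwx₂, hx₂⟩ := exists_support_above hw₀X.le
  -- At a wall in `H` the incidence number is `τ` times the sign at `H`. So the function equal to `τ
  -- r(w₀)` on the positive side of `H` and zero elsewhere has coboundary `r(w₀)` on the walls in
  -- `H`, and zero on all others.
  let τ : SignType := x₂.sign H * inc ε w₀ x₂
  have hτ : ∀ w x : Face A, w ≤ x → w.support = w₀.support → x.support = X →
      inc ε w x = τ * x.sign H := by
    intro w x hwx hw hx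
    have h1 := inc_mul_sign (ε := ε) hw₀X hw₀H' hXH' hwx₂ rfl hx₂ hwx hw hx
    have h2 := hXH x₂ hx₂
    have h3 := hXH x hx
    simp only [τ]
    generalize x.sign H = a at *
    generalize x₂.sign H = b at *
    generalize inc ε w₀ x₂ = c at *
    generalize inc ε w x = d at *
    revert a b c d
    decide
  refine ⟨fun x => h x + if x.sign H = 1 then (τ : k) * r w₀ else 0, fun w hws hwX => ?_⟩
  obtain ⟨x, hwx, hx⟩ := exists_support_above hwX.le
  rw [cobd_eq _ hwx hx hwX]
  by_cases hwH : w.sign H = 0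
  · have hww : w.support = w₀.support :=
      CovBy.eq_of_le hwX hw₀X (support_le_of_sign_eq_zero hwX.le hw₀ hwH)
    have h1 := hconst w hws hww
    simp only [r] at h1 ⊢
    have h2 := cobd_eq (ε := ε) h hwx hx hwX
    have h3 := flip_sign (x := x) (supp_le_iff_sign.2 hwH)
    have h4 : τ ≠ 0 := by
      have := inc_ne_zero (ε := ε) (w := w₀) (x := x₂) (by rw [hx₂]; exact hw₀X) hwx₂
      have h2 := hXH x₂ hx₂
      simp only [τ]
      generalize x₂.sign H = b at *
      generalize inc ε w₀ x₂ = c at *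
      revert b c
      decide
    have h5 := coe_sign_mul_self (k := k) h4
    rw [← h1, h3]
    rw [hτ w x hwx hww hx] at h2 ⊢
    rcases eq_one_or_eq_neg_one (hXH x hx) with h6 | h6 <;> rw [h6] at h2 ⊢ <;> simp at h2 ⊢ <;>
      linear_combination h2 - (g w - cobd ε X h w) * h5
  · have e1 : x.sign H = w.sign H := (sign_eq_of_le hwx hwH).symm
    have e2 : (flip w x).sign H = w.sign H := (sign_eq_of_le (le_flip w x) hwH).symm
    rw [off w hws hwX hwH, cobd_eq _ hwx hx hwX, e1, e2]
    ring

open Classical in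
/-- Exactness of the cellular complex of the faces with support at most `X` in homological degree
one. -/
theorem exists_boundary (X : IntersectionLattice A) (m : Face A → k)
    (hm : ∀ x : Face A, x.support = X →
      ∑ w with w.support ⋖ X, ((inc ε w x : SignType) : k) * m w = 0) :
    ∃ n : Face A → k, ∀ w, w.support ⋖ X →
      m w = ∑ z, ((inc ε z w : SignType) : k) * n z := by
  let T : (Face A → k) →ₗ[k] (Face A → k) :=
    LinearMap.pi fun w => if w.support ⋖ X then
      ∑ z, ((inc ε z w : SignType) : k) • LinearMap.proj z else 0
  have hT : ∀ n w, T n w = if w.support ⋖ X then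
      ∑ z, ((inc ε z w : SignType) : k) * n z else 0 := by
    intro n w
    simp only [T, LinearMap.pi_apply]
    split_ifs <;> simp
  let m' : Face A → k := fun w => if w.support ⋖ X then m w else 0
  by_cases hmem : m' ∈ LinearMap.range T
  · obtain ⟨n, hn⟩ := hmem
    refine ⟨n, fun w hw => ?_⟩
    have := congrFun hn w
    rw [hT, if_pos hw] at this
    rw [this]
    simp [m', hw]
  · exfalso
    -- Otherwise a functional `f` kills all boundaries but not `m'`. Its coordinates `g` form a
    -- cocycle, so `g` is the coboundary of some `h` (the region `s = 0` imposes no condition), and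
    -- `f m'` pairs `h` with the boundary of `m`, which is zero.
    obtain ⟨f, hf, hle⟩ := Submodule.exists_le_ker_of_notMem hmem
    let g : Face A → k := fun w => f (Pi.single w 1)
    have hfg : ∀ u, f u = ∑ w, u w * g w := by
      intro u
      rw [LinearMap.pi_apply_eq_sum_univ f u]
      refine Finset.sum_congr rfl fun w _ => ?_
      simp only [g, smul_eq_mul]
      congr 2
      ext j
      simp [Pi.single_apply, eq_comm]
    obtain ⟨h, hh⟩ := exists_primitive (ε := ε) X g 0 (by
      intro z _
      have h0 : f (T (Pi.single z 1)) = 0 := hle ⟨_, rfl⟩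
      rw [hfg] at h0
      rw [Finset.sum_filter]
      refine (Finset.sum_congr rfl fun w _ => ?_).trans h0
      rw [hT]
      split_ifs
      · simp [Pi.single_apply]
      · simp)
    apply hf
    rw [hfg]
    have h1 : ∀ w, m' w * g w = ∑ x with x.support = X,
        (if w.support ⋖ X then ((inc ε w x : SignType) : k) * m w else 0) * h x := by
      intro w
      simp only [m']
      split_ifs with hw
      · rw [hh w (fun H => Or.inl rfl) hw, cobd, Finset.mul_sum]
        refine Finset.sum_congr rfl fun x _ => ?_
        ring
      · simp
    simp only [h1]
    rw [Finset.sum_comm]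
    refine Finset.sum_eq_zero fun x hx => ?_
    rw [← Finset.sum_mul, ← Finset.sum_filter, hm x (by simpa using hx), zero_mul]

end CentralArrangement

namespace CentralArrangement

variable {V : Type*} [AddCommGroup V] [Module ℝ V] {A : CentralArrangement V} (k : Type*)
  [Field k]

open Face

/-! ### Idempotents of the face algebra -/

/-- A face as an element of the face algebra. -/
noncomputable def fc (w : Face A) : FaceAlgebra k A := MonoidAlgebra.single w 1

theorem fc_mul_fc (w x : Face A) : fc k w * fc k x = fc k (w * x) := by
  simp [fc, MonoidAlgebra.single_mul_single]

theorem fc_one : fc k (1 : Face A) = 1 := rfl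

theorem fc_induction {P : FaceAlgebra k A → Prop} (a : FaceAlgebra k A) (h0 : P 0)
    (hadd : ∀ a b, P a → P b → P (a + b)) (h : ∀ (r : k) w, P (r • fc k w)) : P a := by
  induction a using MonoidAlgebra.induction_linear with
  | zero => exact h0
  | add a b ha hb => exact hadd a b ha hb
  | single w r =>
    have := h r w
    rwa [fc, MonoidAlgebra.smul_single, smul_eq_mul, mul_one] at this

variable {c : IntersectionLattice A → Face A}

open Classical in
theorem idem_eq_sum (c : IntersectionLattice A → Face A) (X : IntersectionLattice A) :
    idem k c X = fc k (c X) - ∑ Y with X < Y, fc k (c X) * idem k c Y := by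
  rw [idem_eq k c X, Finset.sum_subtype (p := fun Y => X < Y)
    (Finset.univ.filter fun Y => X < Y) (fun Y => by simp)]
  rfl

variable (hc : ∀ X, (c X).support = X)

include hc in
open Classical in
-- Since `w * c X = w` for faces of equal support, the recursion for `e_X` holds after left
-- multiplication with any face of support `X`.
theorem fc_mul_idem_of_support {w : Face A} {X : IntersectionLattice A} (hw : w.support = X) :
    fc k w * idem k c X = fc k w - ∑ Y with X < Y, fc k w * idem k c Y := by
  have h : fc k w * fc k (c X) = fc k w := by
    rw [fc_mul_fc, mul_eq_left_of_support_le]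
    rw [hc, hw]
  rw [idem_eq_sum, mul_sub, Finset.mul_sum, h]
  simp only [← mul_assoc, h]

include hc in
open Classical in
-- Downward induction on `X`. The support of `u = w * c X` is strictly above `X`. By induction only
-- the `Y ≥ supp u` survive in the recursion for `w e_X`, and what remains is the recursion for `u
-- e_{supp u}`, which cancels.
theorem fc_mul_idem_eq_zero {w : Face A} {X : IntersectionLattice A} (h : ¬ w.support ≤ X) :
    fc k w * idem k c X = 0 := by
  induction X using WellFoundedGT.induction generalizing w with
  | ind X ih =>
  rw [idem_eq_sum, mul_sub, Finset.mul_sum]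
  simp only [← mul_assoc, fc_mul_fc]
  set u := w * c X with hu
  have hXu : X ≤ u.support := ((support_mul_le_iff (x := w) (y := c X)).1 le_rfl).2.trans' (hc X).ge
  have hXu' : X < u.support := by
    refine lt_of_le_of_ne hXu fun e => h ?_
    rw [e]
    exact ((support_mul_le_iff (x := w) (y := c X)).1 le_rfl).1
  have h1 := fc_mul_idem_of_support k hc (w := u) rfl
  have h2 : ∑ Y with X < Y, fc k u * idem k c Y =
      ∑ Y with u.support ≤ Y, fc k u * idem k c Y := by
    symm
    refine Finset.sum_subset (fun Y hY => ?_) fun Y hY hY' => ?_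
    · simp only [Finset.mem_filter, Finset.mem_univ, true_and] at hY ⊢
      exact hXu'.trans_le hY
    · simp only [Finset.mem_filter, Finset.mem_univ, true_and] at hY hY'
      exact ih Y hY hY'
  have h3 : (Finset.univ.filter fun Y => u.support ≤ Y) =
      insert u.support (Finset.univ.filter fun Y => u.support < Y) := by
    ext Y
    simp [le_iff_eq_or_lt, eq_comm]
  rw [h2, h3, Finset.sum_insert (by simp), h1]
  abel

include hc in
-- Only `Y ≥ supp w` contribute, and their sum is the recursion at `supp w`. For `w = 1` this says
-- that the `e_Y` are complete.
theorem sum_fc_mul_idem (w : Face A) : ∑ Y, fc k w * idem k c Y = fc k w := by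
  classical
  have h1 := fc_mul_idem_of_support k hc (w := w) rfl
  have h3 : (Finset.univ.filter fun Y => w.support ≤ Y) =
      insert w.support (Finset.univ.filter fun Y => w.support < Y) := by
    ext Y
    simp [le_iff_eq_or_lt, eq_comm]
  rw [← Finset.sum_subset (Finset.subset_univ (Finset.univ.filter fun Y => w.support ≤ Y)),
    h3, Finset.sum_insert (by simp), h1]
  · abel
  · intro Y _ hY
    exact fc_mul_idem_eq_zero k hc (by simpa using hY)

include hc in
theorem sum_idem : ∑ Y, idem k c Y = 1 := by
  have := sum_fc_mul_idem k hc 1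
  simpa [fc_one] using this

include hc in
theorem fc_mul_idem_self (X : IntersectionLattice A) :
    fc k (c X) * idem k c X = idem k c X := by
  classical
  rw [fc_mul_idem_of_support k hc (hc X), ← idem_eq_sum]

include hc in
theorem fc_mul_mul_idem_eq_zero {w : Face A} {X : IntersectionLattice A} (h : ¬ w.support ≤ X)
    (a : FaceAlgebra k A) : fc k w * a * idem k c X = 0 := by
  induction a using fc_induction with
  | h0 => simp
  | hadd a b ha hb => rw [mul_add, add_mul, ha, hb, add_zero]
  | h r x =>
    rw [mul_smul_comm, smul_mul_assoc, fc_mul_fc, fc_mul_idem_eq_zero k hc, smul_zero]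
    exact fun h' => h (support_mul_le_iff.1 h').1

include hc in
-- Triangularity: `e_X` absorbs `c X` on the left, and a face whose support is not below `Y`
-- annihilates `kF e_Y`.
theorem idem_mul_mul_idem_eq_zero {X Y : IntersectionLattice A} (h : ¬ X ≤ Y)
    (a : FaceAlgebra k A) : idem k c X * a * idem k c Y = 0 := by
  rw [← fc_mul_idem_self k hc X, mul_assoc (fc k (c X)), fc_mul_mul_idem_eq_zero k hc]
  rwa [hc]

include hc in
theorem idem_mul_idem_eq_zero {X Y : IntersectionLattice A} (h : ¬ X ≤ Y) :
    idem k c X * idem k c Y = 0 := by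
  simpa using idem_mul_mul_idem_eq_zero k hc h 1

include hc in
theorem idem_mul_self (X : IntersectionLattice A) :
    idem k c X * idem k c X = idem k c X := by
  classical
  nth_rw 1 [idem_eq_sum k c X]
  rw [sub_mul, fc_mul_idem_self k hc, Finset.sum_mul, Finset.sum_eq_zero, sub_zero]
  intro Y hY
  simp only [Finset.mem_filter, Finset.mem_univ, true_and] at hY
  rw [mul_assoc, idem_mul_idem_eq_zero k hc hY.not_ge, mul_zero]

include hc in
-- For `X < Y`, downward induction leaves only the summand of `Y` in the expansion of `e_X`, and it
-- cancels against `c X * e_Y`.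
theorem idem_mul_idem_of_ne {X Y : IntersectionLattice A} (h : X ≠ Y) :
    idem k c X * idem k c Y = 0 := by
  classical
  induction X using WellFoundedGT.induction with
  | ind X ih =>
  by_cases hXY : X ≤ Y
  · have hlt : X < Y := lt_of_le_of_ne hXY h
    rw [idem_eq_sum k c X, sub_mul, Finset.sum_mul, Finset.sum_eq_single Y, mul_assoc,
      idem_mul_self k hc, sub_self]
    · intro W hW hWY
      simp only [Finset.mem_filter, Finset.mem_univ, true_and] at hW
      rw [mul_assoc, ih W hW hWY, mul_zero]
    · simp [hlt]
  · exact idem_mul_idem_eq_zero k hc hXY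

theorem idem_mul_idem_mul (hc : ∀ X, (c X).support = X)
    (X Y : IntersectionLattice A) (b : FaceAlgebra k A) :
    idem k c Y * (idem k c Y * b * idem k c X) = idem k c Y * b * idem k c X := by
  rw [← mul_assoc, ← mul_assoc, idem_mul_self k hc]

theorem mul_idem_mul_idem (hc : ∀ X, (c X).support = X)
    (X Y : IntersectionLattice A) (b : FaceAlgebra k A) :
    idem k c Y * b * idem k c X * idem k c X = idem k c Y * b * idem k c X := by
  rw [mul_assoc, idem_mul_self k hc]

include hc in
-- The result does not depend on `x`, so `e_X` kills `(x - x') e_X` for two faces of support `X`.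
-- This is what makes boundaries vanish in `idem_mul_bd`.
theorem idem_mul_fc_mul_idem {X : IntersectionLattice A} {x : Face A} (hx : x.support = X) :
    idem k c X * fc k x * idem k c X = idem k c X := by
  classical
  nth_rw 1 [idem_eq_sum k c X]
  rw [sub_mul, sub_mul, Finset.sum_mul, Finset.sum_mul, Finset.sum_eq_zero, sub_zero, fc_mul_fc,
    mul_eq_left_of_support_le, fc_mul_idem_self k hc]
  · rw [hc, hx]
  · intro Y hY
    simp only [Finset.mem_filter, Finset.mem_univ, true_and] at hY
    rw [mul_assoc (fc k (c X)), mul_assoc (fc k (c X)),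
      idem_mul_mul_idem_eq_zero k hc hY.not_ge, mul_zero]

/-! ### The basis of faces times idempotents -/

/-- The linear map that takes the function `m` to the sum of the elements `m w • w e_X`, where
`X` is the support of `w`. -/
noncomputable def theta (c : IntersectionLattice A → Face A) :
    (Face A → k) →ₗ[k] FaceAlgebra k A :=
  Fintype.linearCombination k fun w => fc k w * idem k c w.support

theorem theta_apply (m : Face A → k) :
    theta k c m = ∑ w, m w • (fc k w * idem k c w.support) := rfl

include hc in
theorem fc_mul_idem_mem_range (w : Face A) (Y : IntersectionLattice A) :
    fc k w * idem k c Y = 0 ∨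
      ∃ x : Face A, x.support = Y ∧ fc k w * idem k c Y = fc k x * idem k c x.support := by
  by_cases h : w.support ≤ Y
  · right
    have hs : (w * c Y).support = Y := by
      rw [support_mul, hc]
      rwa [hc]
    exact ⟨w * c Y, hs, by rw [hs, ← fc_mul_fc, mul_assoc, fc_mul_idem_self k hc]⟩
  · exact Or.inl (fc_mul_idem_eq_zero k hc h)

theorem theta_single [DecidableEq (Face A)] (w : Face A) :
    theta k c (Pi.single w 1) = fc k w * idem k c w.support := by
  rw [theta, Fintype.linearCombination_apply_single, one_smul]

include hc in
theorem theta_surjective : Function.Surjective (theta k c) := by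
  classical
  rw [← LinearMap.range_eq_top, eq_top_iff]
  rintro a -
  induction a using fc_induction with
  | h0 => exact zero_mem _
  | hadd a b ha hb => exact add_mem ha hb
  | h r w =>
    refine Submodule.smul_mem _ _ ?_
    rw [← sum_fc_mul_idem k hc w]
    refine Submodule.sum_mem _ fun Y _ => ?_
    rcases fc_mul_idem_mem_range k hc w Y with h | ⟨x, -, h⟩
    · rw [h]
      exact zero_mem _
    · exact ⟨Pi.single x 1, by rw [theta_single, h]⟩

include hc in
-- The spanning family is indexed by the faces, and their number is the dimension of `kF`.
theorem theta_injective : Function.Injective (theta k c) := by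
  classical
  have b : Module.Basis (Face A) k (FaceAlgebra k A) := MonoidAlgebra.basis _ _
  have := Module.Finite.of_basis b
  refine (LinearMap.injective_iff_surjective_of_finrank_eq_finrank ?_).2 (theta_surjective k hc)
  rw [Module.finrank_eq_card_basis b, Module.finrank_fintype_fun_eq_card]

include hc in
theorem theta_mul_idem (m : Face A → k) (X : IntersectionLattice A)
    [DecidableEq (IntersectionLattice A)] :
    theta k c m * idem k c X = theta k c fun w => if w.support = X then m w else 0 := by
  rw [theta_apply, theta_apply, Finset.sum_mul]
  refine Finset.sum_congr rfl fun w _ => ?_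
  rw [smul_mul_assoc, mul_assoc]
  split_ifs with h
  · rw [h, idem_mul_self k hc]
  · rw [idem_mul_idem_of_ne k hc h, mul_zero, smul_zero, zero_smul]

theorem flip_mul {y w x : Face A} (h : w.support = y.support) :
    w * flip y x = flip w (w * x) := by
  ext H
  rw [mul_sign, flip, flip, mul_sign, mul_sign, opp_sign, opp_sign, mul_sign]
  have := support_eq_iff.1 h H
  split_ifs <;> simp_all

/-! ### Multiplication by the images of the arrows -/

section

variable [FiniteDimensional ℝ V] {ε : Orientations A}

open Classical in
-- `∂(y)` runs over all covers of `y`, whereas `inc` sees only faces whose supports cover. The two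
-- agree after multiplication by `e_X`: it kills faces of support not below `X`, and between `Y ⋖ X`
-- no support other than `X` is left.
theorem boundary_mul_idem_eq_sum (hc : ∀ X, (c X).support = X) {Y X : IntersectionLattice A}
    (h : Y ⋖ X) {y : Face A} (hy : y.support = Y) :
    boundary k ε y * idem k c X =
      ∑ x with x.support = X, ((inc ε y x : SignType) : k) • (fc k x * idem k c X) := by
  subst hy
  have h1 : ∀ x : {x : Face A // y ⋖ x}, MonoidAlgebra.single x.1 ((incidence ε x.2 : SignType) : k)
      * idem k c X = ((inc ε y x.1 : SignType) : k) • (fc k x.1 * idem k c X) := by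
    rintro ⟨x, hx⟩
    by_cases hxX : x.support ≤ X
    · have hlt : y.support < x.support := lt_of_le_of_ne (support_mono hx.le) fun e =>
        hx.ne (eq_of_le_of_support_eq hx.le e)
      have hX : x.support = X := by
        rcases hxX.eq_or_lt with e | e
        · exact e
        · exact absurd e (h.2 hlt)
      have hin : inc ε y x = incidence ε hx := dif_pos ⟨hx.le, by rw [hX]; exact h⟩
      simp only [hin]
      rw [← smul_mul_assoc, fc, MonoidAlgebra.smul_single, smul_eq_mul, mul_one]
    · rw [fc_mul_idem_eq_zero k hc hxX, smul_zero]
      have : MonoidAlgebra.single x ((incidence ε hx : SignType) : k) =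
          ((incidence ε hx : SignType) : k) • fc k x := by
        rw [fc, MonoidAlgebra.smul_single, smul_eq_mul, mul_one]
      rw [this, smul_mul_assoc, fc_mul_idem_eq_zero k hc hxX, smul_zero]
  rw [boundary, Finset.sum_mul, Finset.sum_congr rfl fun x _ => h1 x,
    ← Finset.sum_subtype (Finset.univ.filter fun x => y ⋖ x) (by simp)
      fun x => ((inc ε y x : SignType) : k) • (fc k x * idem k c X)]
  rw [Finset.sum_filter, Finset.sum_filter]
  refine Finset.sum_congr rfl fun x _ => ?_
  by_cases hin : inc ε y x = 0
  · simp [hin]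
  · obtain ⟨h2, h3⟩ := of_inc_ne_zero hin
    rw [if_pos (covBy_of_support h2 h3)]
    split_ifs with h4
    · rfl
    · rw [fc_mul_idem_eq_zero k hc, smul_zero]
      exact fun h5 => h4 ((h5.eq_or_lt).resolve_right fun h6 => h.2 h3.lt h6)

variable (ε) in
open Classical in
/-- The component in `X` of the boundary of `w`, times `e_X`. -/
noncomputable def bd (c : IntersectionLattice A → Face A) (X : IntersectionLattice A)
    (w : Face A) : FaceAlgebra k A :=
  ∑ x with x.support = X, ((inc ε w x : SignType) : k) • (fc k x * idem k c X)

theorem bd_eq {X : IntersectionLattice A} {w x : Face A} (hwx : w ≤ x)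
    (hx : x.support = X) (h : w.support ⋖ X) :
    bd k ε c X w = ((inc ε w x : SignType) : k) •
      (fc k x * idem k c X - fc k (flip w x) * idem k c X) := by
  subst hx
  rw [bd, sum_inc_smul (k := k) hwx h fun x => fc k x * idem k c _]

/-- For `W = X` the two sides of the wall contribute `e_X` with opposite signs. Any other `W > Y` is
not below `X`, and triangularity applies. -/
theorem idem_mul_bd (hc : ∀ X, (c X).support = X) {Y X W : IntersectionLattice A} (h : Y ⋖ X)
    (hW : Y < W) {y : Face A} (hy : y.support = Y) :
    idem k c W * bd k ε c X y = 0 := by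
  subst hy
  by_cases hWX : W ≤ X
  · have hWX' : W = X := (hWX.eq_or_lt).resolve_right fun h6 => h.2 hW h6
    subst hWX'
    obtain ⟨x, hyx, hx⟩ := exists_support_above h.le
    rw [bd_eq k hyx hx h, mul_smul_comm, mul_sub, ← mul_assoc, ← mul_assoc,
      idem_mul_fc_mul_idem k hc hx, idem_mul_fc_mul_idem k hc ((support_flip hyx).trans hx),
      sub_self, smul_zero]
  · rw [bd, Finset.mul_sum]
    refine Finset.sum_eq_zero fun x _ => ?_
    rw [mul_smul_comm, ← mul_assoc, idem_mul_mul_idem_eq_zero k hc hWX, smul_zero]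

/-- Left multiplication by `w` carries the two faces above `y` to the two faces above `w`. Their
sign at a hyperplane through `Y` is kept, and hence so is the incidence number. -/
theorem fc_mul_bd {Y X : IntersectionLattice A} (h : Y ⋖ X) {w y : Face A}
    (hw : w.support = Y) (hy : y.support = Y) :
    fc k w * bd k ε c X y = bd k ε c X w := by
  obtain ⟨x, hyx, hx⟩ := exists_support_above (w := y) (X := X) (by rw [hy]; exact h.le)
  have hs : (w * x).support = X := by
    rw [support_mul, hx]
    rw [hw, hx]
    exact h.le
  rw [bd_eq k hyx hx (by rwa [hy]), bd_eq k (le_mul w x) hs (by rwa [hw]), mul_smul_comm, mul_sub,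
    ← mul_assoc, ← mul_assoc, fc_mul_fc, fc_mul_fc, flip_mul (hw.trans hy.symm)]
  obtain ⟨H, h1, h2⟩ := exists_hyperplane_of_lt h.lt
  have e := inc_mul_sign (ε := ε) h h1 h2 hyx hy hx (le_mul w x) hw hs
  have hwH : w.sign H = 0 := by
    rw [← supp_le_iff_sign, ← support_coe, hw]
    exact h1
  have hxH : x.sign H ≠ 0 := by
    rw [← hx] at h2
    exact fun h => h2 (supp_le_iff_sign.2 h)
  rw [mul_sign, if_pos hwH] at e
  rw [mul_left_cancel₀ hxH e]

include hc in
theorem fc_mul_idem_mul_bd {Y X : IntersectionLattice A} (h : Y ⋖ X) {w : Face A}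
    (hw : w.support = Y) :
    fc k w * idem k c Y * bd k ε c X (c Y) = bd k ε c X w := by
  classical
  rw [fc_mul_idem_of_support k hc hw, sub_mul, Finset.sum_mul, fc_mul_bd k h hw (hc Y),
    Finset.sum_eq_zero, sub_zero]
  intro W hW
  simp only [Finset.mem_filter, Finset.mem_univ, true_and] at hW
  rw [mul_assoc, idem_mul_bd k hc h hW (hc Y), mul_zero]

include hc in
/-- The image of an arrow. -/
theorem idem_mul_boundary_mul_idem {Y X : IntersectionLattice A} (h : Y ⋖ X) :
    idem k c Y * boundary k ε (c Y) * idem k c X = idem k c Y * bd k ε c X (c Y) := by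
  rw [mul_assoc, boundary_mul_idem_eq_sum k hc h (hc Y)]
  rfl

open Classical in
include hc in
-- The dictionary between the algebra and the complex: since `w e_Y ∂(c Y) e_X` is the `X`-component
-- of the boundary of `w`, the choice of `c Y` disappears.
theorem theta_mul_arrow {Y X : IntersectionLattice A} (h : Y ⋖ X) (m : Face A → k) :
    theta k c m * (idem k c Y * boundary k ε (c Y) * idem k c X) =
      theta k c fun x => if x.support = X then
        ∑ w with w.support = Y, ((inc ε w x : SignType) : k) * m w else 0 := by
  rw [idem_mul_boundary_mul_idem k hc h, ← mul_assoc, theta_mul_idem k hc, theta_apply,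
    theta_apply, Finset.sum_mul]
  have h1 : ∀ w : Face A, (if w.support = Y then m w else 0) •
      (fc k w * idem k c w.support) * bd k ε c X (c Y) =
        if w.support = Y then m w • bd k ε c X w else 0 := by
    intro w
    split_ifs with hw
    · rw [smul_mul_assoc, hw, fc_mul_idem_mul_bd k hc h hw]
    · simp
  rw [Finset.sum_congr rfl fun w _ => h1 w, ← Finset.sum_filter]
  simp only [bd, Finset.smul_sum]
  rw [Finset.sum_comm, Finset.sum_filter]
  refine Finset.sum_congr rfl fun x _ => ?_
  split_ifs with hx
  · rw [Finset.sum_smul]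
    refine Finset.sum_congr rfl fun w _ => ?_
    rw [smul_smul, hx, mul_comm]
  · simp

end

end CentralArrangement

/-! ### Homomorphisms from path algebras and ideals of paths -/

namespace PathAlgebra

variable {k Q : Type*} [Field k] [Quiver Q]

theorem ofPath_cons {a b c : Q} (p : Quiver.Path a b) (f : b ⟶ c) :
    ofPath k (p.cons f) = arrow k f * ofPath k p := by
  rw [arrow, ofPath_mul_ofPath]
  rfl

theorem ofPath_mul_vertex {a b : Q} (p : Quiver.Path a b) :
    ofPath k p * vertex k a = ofPath k p := by
  rw [vertex, ofPath_mul_ofPath, Quiver.Path.nil_comp]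

theorem ofPath_mul_vertex_of_ne {a b c : Q} (p : Quiver.Path a b) (h : c ≠ a) :
    ofPath k p * vertex k c = 0 := ofPath_mul_ofPath_of_ne _ _ h

theorem vertex_mul_ofPath {a b : Q} (p : Quiver.Path a b) :
    vertex k b * ofPath k p = ofPath k p := by
  rw [vertex, ofPath_mul_ofPath, Quiver.Path.comp_nil]

section lift

variable {B : Type*} [Ring B] [Algebra k B]

/-- The product of the values of the arrows along a path. -/
def pathVal (v : Q → B) (f : ∀ {a b : Q}, (a ⟶ b) → B) {a : Q} : ∀ {b : Q}, Quiver.Path a b → B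
  | _, .nil => v a
  | _, .cons p e => f e * pathVal v f p

variable {v : Q → B} {f : ∀ {a b : Q}, (a ⟶ b) → B}

theorem mul_pathVal (hv : ∀ a, v a * v a = v a)
    (hf : ∀ {a b : Q} (e : a ⟶ b), v b * f e = f e) {a b : Q} (p : Quiver.Path a b) :
    v b * pathVal v f p = pathVal v f p := by
  cases p with
  | nil => exact hv a
  | cons p e => rw [pathVal, ← mul_assoc, hf]

theorem pathVal_comp (hf : ∀ {a b : Q} (e : a ⟶ b), v b * f e = f e)
    (hv : ∀ a, v a * v a = v a) {a b c : Q} (p : Quiver.Path a b) (q : Quiver.Path b c) :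
    pathVal v f (p.comp q) = pathVal v f q * pathVal v f p := by
  induction q with
  | nil => exact (mul_pathVal hv hf p).symm
  | cons q e ih => rw [Quiver.Path.comp_cons, pathVal, pathVal, ih, mul_assoc]

theorem pathVal_mul (hv : ∀ a, v a * v a = v a) {a b : Q} (p : Quiver.Path a b) :
    pathVal v f p * v a = pathVal v f p := by
  induction p with
  | nil => exact hv a
  | cons p e ih => rw [pathVal, mul_assoc, ih]

theorem exists_algHom [Fintype Q] (hv : ∀ a, v a * v a = v a)
    (hv' : ∀ a b, a ≠ b → v a * v b = 0) (h1 : ∑ a, v a = 1)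
    (hf : ∀ {a b : Q} (e : a ⟶ b), v b * f e = f e)
    (hf' : ∀ {a b : Q} (e : a ⟶ b), f e * v a = f e) :
    ∃ φ : PathAlgebra k Q →ₐ[k] B, (∀ a, φ (vertex k a) = v a) ∧
      ∀ (a b : Q) (e : a ⟶ b), φ (arrow k e) = f e := by
  let L : PathAlgebra k Q →ₗ[k] B := (basis k Q).constr k fun p => pathVal v f p.path
  have hL : ∀ {a b : Q} (p : Quiver.Path a b), L (ofPath k p) = pathVal v f p := by
    intro a b p
    simp [L, ofPath]
  refine ⟨AlgHom.ofLinearMap L ?_ ?_, fun a => hL _, fun a b e => (hL _).trans (hf' e)⟩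
  · rw [one_def, map_sum, ← h1]
    exact Finset.sum_congr rfl fun a _ => hL _
  · intro x y
    induction x using induction_on with
    | h0 => simp
    | hadd x x' hx hx' => simp only [add_mul, map_add, hx, hx']
    | h r p =>
    induction y using induction_on with
    | h0 => simp
    | hadd x x' hx hx' => simp only [mul_add, map_add, hx, hx']
    | h s q =>
    rename_i a b c d
    simp only [smul_mul_assoc, mul_smul_comm, map_smul, hL]
    congr 2
    by_cases h : d = a
    · subst h
      rw [ofPath_mul_ofPath, hL, pathVal_comp hf hv]
    · rw [ofPath_mul_ofPath_of_ne _ _ h, map_zero, ← mul_pathVal hv hf q, ← pathVal_mul hv p,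
        mul_assoc, ← mul_assoc (v a), hv' _ _ (Ne.symm h), zero_mul, mul_zero]

theorem algHom_ext [Fintype Q] {φ ψ : PathAlgebra k Q →ₐ[k] B}
    (hv : ∀ a, φ (vertex k a) = ψ (vertex k a))
    (hf : ∀ (a b : Q) (e : a ⟶ b), φ (arrow k e) = ψ (arrow k e)) : φ = ψ := by
  have hp : ∀ {a b : Q} (p : Quiver.Path a b), φ (ofPath k p) = ψ (ofPath k p) := by
    intro a b p
    induction p with
    | nil => exact hv a
    | cons p e ih => rw [ofPath_cons, map_mul, map_mul, hf, ih]
  ext x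
  induction x using induction_on with
  | h0 => simp
  | hadd x y hx hy => rw [map_add, map_add, hx, hy]
  | h r p => rw [map_smul, map_smul, hp]

end lift

/-- The span of the paths with a given property. -/
noncomputable def pathSpan (k : Type*) {Q : Type*} [Field k] [Quiver Q] (C : QuiverPath Q → Prop) :
    Submodule k (PathAlgebra k Q) :=
  Submodule.span k {x | ∃ (a b : Q) (p : Quiver.Path a b), C ⟨a, b, p⟩ ∧ x = ofPath k p}

theorem ofPath_mem_pathSpan {C : QuiverPath Q → Prop} {a b : Q} {p : Quiver.Path a b}
    (h : C ⟨a, b, p⟩) : ofPath k p ∈ pathSpan k C :=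
  Submodule.subset_span ⟨a, b, p, h, rfl⟩

theorem repr_eq_zero_of_mem_pathSpan {C : QuiverPath Q → Prop} {x : PathAlgebra k Q}
    (hx : x ∈ pathSpan k C) {p : QuiverPath Q} (hp : ¬ C p) : (basis k Q).repr x p = 0 := by
  induction hx using Submodule.span_induction with
  | mem x h =>
    obtain ⟨a, b, q, hq, rfl⟩ := h
    rw [ofPath, Module.Basis.repr_self, Finsupp.single_eq_of_ne]
    rintro rfl
    exact hp hq
  | zero => simp
  | add x y _ _ hx hy => simp [hx, hy]
  | smul r x _ hx => simp [hx]

/-- The ideal spanned by the paths with a property that passes to longer paths. -/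
noncomputable def pathIdeal [Fintype Q] (C : QuiverPath Q → Prop)
    (hl : ∀ {a b c : Q} (p : Quiver.Path a b) (q : Quiver.Path b c),
      C ⟨a, b, p⟩ → C ⟨a, c, p.comp q⟩)
    (hr : ∀ {a b c : Q} (p : Quiver.Path a b) (q : Quiver.Path b c),
      C ⟨b, c, q⟩ → C ⟨a, c, p.comp q⟩) : TwoSidedIdeal (PathAlgebra k Q) :=
  .mk' (pathSpan k C) (zero_mem _) (fun hx hy => add_mem hx hy) (fun hx => neg_mem hx)
    (by
      intro x y hy
      induction x using induction_on with
      | h0 => rw [zero_mul]; exact zero_mem (pathSpan k C)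
      | hadd x x' hx hx' => rw [add_mul]; exact add_mem (S := Submodule _ _) hx hx'
      | h r p =>
        rw [smul_mul_assoc]
        refine Submodule.smul_mem _ _ ?_
        refine Submodule.span_induction ?_ ?_ ?_ ?_ hy
        · rintro _ ⟨c, d, q, hq, rfl⟩
          rename_i a b
          by_cases h : d = a
          · subst h
            rw [ofPath_mul_ofPath]
            exact ofPath_mem_pathSpan (hl q p hq)
          · rw [ofPath_mul_ofPath_of_ne _ _ h]
            exact zero_mem _
        · rw [mul_zero]; exact zero_mem _
        · intro x y _ _ hx hy
          rw [mul_add]; exact add_mem hx hy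
        · intro s x _ hx
          rw [mul_smul_comm]; exact Submodule.smul_mem _ _ hx)
    (by
      intro y x hy
      induction x using induction_on with
      | h0 => rw [mul_zero]; exact zero_mem (pathSpan k C)
      | hadd x x' hx hx' => rw [mul_add]; exact add_mem (S := Submodule _ _) hx hx'
      | h r p =>
        rw [mul_smul_comm]
        refine Submodule.smul_mem _ _ ?_
        refine Submodule.span_induction ?_ ?_ ?_ ?_ hy
        · rintro _ ⟨c, d, q, hq, rfl⟩
          rename_i a b
          by_cases h : b = c
          · subst h
            rw [ofPath_mul_ofPath]
            exact ofPath_mem_pathSpan (hr p q hq)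
          · rw [ofPath_mul_ofPath_of_ne _ _ h]
            exact zero_mem _
        · rw [zero_mul]; exact zero_mem _
        · intro x y _ _ hx hy
          rw [add_mul]; exact add_mem hx hy
        · intro s x _ hx
          rw [smul_mul_assoc]; exact Submodule.smul_mem _ _ hx)

theorem mem_pathIdeal [Fintype Q] {C : QuiverPath Q → Prop} {hl hr} {x : PathAlgebra k Q} :
    x ∈ pathIdeal (k := k) C hl hr ↔ x ∈ pathSpan k C := by
  rw [pathIdeal, TwoSidedIdeal.mem_mk']
  rfl

/-- The span of the paths of length at least `r`. -/
noncomputable def lengthSpan (k Q : Type*) [Field k] [Quiver Q] (r : ℕ) : Submodule k (PathAlgebra k Q) :=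
  pathSpan k fun p => r ≤ p.path.length

theorem lengthSpan_mul_le [Fintype Q] (r s : ℕ) :
    lengthSpan k Q r * lengthSpan k Q s ≤ lengthSpan k Q (r + s) := by
  rw [lengthSpan, pathSpan, lengthSpan, pathSpan, Submodule.span_mul_span, Submodule.span_le]
  rintro _ ⟨_, ⟨a, b, p, hp, rfl⟩, _, ⟨c, d, q, hq, rfl⟩, rfl⟩
  simp only at hp hq ⊢
  by_cases h : d = a
  · subst h
    rw [ofPath_mul_ofPath]
    refine ofPath_mem_pathSpan ?_
    simp only [Quiver.Path.length_comp]
    omega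
  · rw [ofPath_mul_ofPath_of_ne _ _ h]
    exact zero_mem _

theorem arrowIdeal_le_lengthSpan [Fintype Q] : arrowIdeal k Q ≤ lengthSpan k Q 1 := by
  intro x hx
  have : TwoSidedIdeal.span {x : PathAlgebra k Q | ∃ (a b : Q) (f : a ⟶ b), x = arrow k f} ≤
      pathIdeal (k := k) (fun p => 1 ≤ p.path.length)
        (fun p q h => by simp only [Quiver.Path.length_comp] at h ⊢; omega)
        (fun p q h => by simp only [Quiver.Path.length_comp] at h ⊢; omega) := by
    rw [TwoSidedIdeal.span_le]
    rintro _ ⟨a, b, f, rfl⟩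
    exact mem_pathIdeal.2 (ofPath_mem_pathSpan le_rfl)
  exact mem_pathIdeal.1 (this hx)

theorem arrowIdeal_pow_le [Fintype Q] (r : ℕ) : arrowIdeal k Q ^ r ≤ lengthSpan k Q r := by
  induction r with
  | zero =>
    rw [pow_zero, Submodule.one_le, one_def]
    exact Submodule.sum_mem _ fun a _ => ofPath_mem_pathSpan (Nat.zero_le _)
  | succ r ih =>
    rw [pow_succ]
    exact (mul_le_mul' ih arrowIdeal_le_lengthSpan).trans (lengthSpan_mul_le r 1)

theorem arrow_mem_arrowIdeal [Fintype Q] {a b : Q} (f : a ⟶ b) :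
    arrow k f ∈ arrowIdeal k Q :=
  TwoSidedIdeal.subset_span ⟨a, b, f, rfl⟩

theorem lengthSpan_two_le [Fintype Q] : lengthSpan k Q 2 ≤ arrowIdeal k Q ^ 2 := by
  rw [lengthSpan, pathSpan, Submodule.span_le]
  rintro _ ⟨a, b, p, hp, rfl⟩
  rcases p with _ | ⟨p, f⟩
  · simp at hp
  rcases p with _ | ⟨p, g⟩
  · simp at hp
  rw [ofPath_cons, pow_two]
  refine Submodule.mul_mem_mul (arrow_mem_arrowIdeal f) ?_
  rw [ofPath_cons]
  exact TwoSidedIdeal.mul_mem_right _ _ _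
    (TwoSidedIdeal.mem_asIdeal.1 (arrow_mem_arrowIdeal g))

end PathAlgebra

/-! ### Paths in Hasse quivers -/

section HasseQuiver

variable {k P : Type*} [Field k]

open PathAlgebra

open Classical in
/-- The arrow `X ⟶ Y` if `X` covers `Y`, and zero otherwise. -/
noncomputable def coverArrow (k : Type*) [Field k] {P : Type*} [Preorder P] (X Y : P) :
    PathAlgebra k (HasseQuiver P) :=
  if h : Y ⋖ X then arrow k (HasseQuiver.arrow h) else 0

theorem coverArrow_of_covBy [Preorder P] {X Y : P} (h : Y ⋖ X) :
    coverArrow k X Y = arrow k (HasseQuiver.arrow h) := dif_pos h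

theorem coverArrow_of_not_covBy [Preorder P] {X Y : P} (h : ¬ Y ⋖ X) :
    coverArrow k X Y = 0 := dif_neg h

theorem coverArrow_mul_vertex [Preorder P] (X Y : P) :
    coverArrow k X Y * vertex k (HasseQuiver.of X) = coverArrow k X Y := by
  by_cases h : Y ⋖ X
  · rw [coverArrow_of_covBy h, arrow, ofPath_mul_vertex]
  · rw [coverArrow_of_not_covBy h, zero_mul]

theorem vertex_mul_coverArrow [Preorder P] (X Y : P) :
    vertex k (HasseQuiver.of Y) * coverArrow k X Y = coverArrow k X Y := by
  by_cases h : Y ⋖ X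
  · rw [coverArrow_of_covBy h, arrow, vertex_mul_ofPath]
  · rw [coverArrow_of_not_covBy h, mul_zero]

theorem sumPathsTwo_eq [Preorder P] [Fintype P] (Z X : P) :
    sumPathsTwo k Z X = ∑ Y, coverArrow k Y Z * coverArrow k X Y := by
  classical
  have h1 : ∀ Y : {Y : P // Z ⋖ Y ∧ Y ⋖ X}, ofPath k
      ((HasseQuiver.arrow Y.2.2).toPath.comp (HasseQuiver.arrow Y.2.1).toPath) =
        coverArrow k Y.1 Z * coverArrow k X Y.1 := by
    intro Y
    rw [coverArrow_of_covBy Y.2.1, coverArrow_of_covBy Y.2.2, arrow, arrow, ofPath_mul_ofPath]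
  rw [sumPathsTwo, Finset.sum_congr rfl fun Y _ => h1 Y,
    ← Finset.sum_subtype (p := fun Y => Z ⋖ Y ∧ Y ⋖ X)
      (Finset.univ.filter fun Y => Z ⋖ Y ∧ Y ⋖ X) (fun Y => by simp)
      fun Y => coverArrow k Y Z * coverArrow k X Y]
  refine Finset.sum_subset (Finset.subset_univ _) fun Y _ hY => ?_
  simp only [Finset.mem_filter, Finset.mem_univ, true_and, not_and_or] at hY
  rcases hY with h | h
  · rw [coverArrow_of_not_covBy h, zero_mul]
  · rw [coverArrow_of_not_covBy h, mul_zero]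

theorem exists_smul_ofPath_comp_eq [Preorder P] [Fintype P] {X Y : P} (r : k) (h : Y ⋖ X)
    {t : HasseQuiver P} (q : Quiver.Path (HasseQuiver.of Y) t) :
    ∃ b : P → PathAlgebra k (HasseQuiver P),
      r • ofPath k ((HasseQuiver.arrow h).toPath.comp q) = ∑ Y, b Y * coverArrow k X Y := by
  classical
  refine ⟨Pi.single Y (r • ofPath k q), ?_⟩
  rw [Finset.sum_eq_single Y]
  · rw [Pi.single_eq_same, coverArrow_of_covBy h, smul_mul_assoc, arrow, ofPath_mul_ofPath]
  · intro Y' _ hY'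
    rw [Pi.single_eq_of_ne hY', zero_mul]
  · simp

/-- Paths starting at `X` are trivial or start with an arrow. -/
theorem exists_mul_vertex_eq [Preorder P] [Fintype P] (a : PathAlgebra k (HasseQuiver P))
    (X : P) : ∃ (r : k) (b : P → PathAlgebra k (HasseQuiver P)),
      a * vertex k (HasseQuiver.of X) =
        r • vertex k (HasseQuiver.of X) + ∑ Y, b Y * coverArrow k X Y := by
  classical
  induction a using PathAlgebra.induction_on with
  | h0 => exact ⟨0, 0, by simp⟩
  | hadd a a' ha ha' =>
    obtain ⟨r, b, h⟩ := ha
    obtain ⟨r', b', h'⟩ := ha'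
    refine ⟨r + r', b + b', ?_⟩
    rw [add_mul, h, h', add_smul]
    simp only [Pi.add_apply, add_mul, Finset.sum_add_distrib]
    abel
  | h r p =>
    rename_i s t
    by_cases hs : s = HasseQuiver.of X
    · revert p
      rw [hs]
      intro p
      rw [smul_mul_assoc, ofPath_mul_vertex]
      by_cases hp : p.length = 0
      · have := p.eq_of_length_zero hp
        subst this
        rw [p.eq_nil_of_length_zero hp]
        exact ⟨r, 0, by simp [vertex]⟩
      · obtain ⟨Y, e, q, -, rfl⟩ := p.eq_toPath_comp_of_length_eq_succ
          (Nat.succ_pred_eq_of_ne_zero hp).symm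
        obtain ⟨b, hb⟩ := exists_smul_ofPath_comp_eq (P := P) (X := X) (Y := Y) r e.down q
        exact ⟨0, b, by rw [zero_smul, zero_add]; exact hb⟩
    · refine ⟨0, 0, ?_⟩
      rw [smul_mul_assoc, ofPath_mul_vertex_of_ne _ (Ne.symm hs)]
      simp

/-- The path `X → Y → Z`. -/
def pathTwo [Preorder P] {Z Y X : P} (h₁ : Z ⋖ Y) (h₂ : Y ⋖ X) :
    Quiver.Path (HasseQuiver.of X) (HasseQuiver.of Z) :=
  (HasseQuiver.arrow h₂).toPath.comp (HasseQuiver.arrow h₁).toPath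

theorem pathTwo_injective [Preorder P] {Z Y Y' X : P} {h₁ : Z ⋖ Y} {h₂ : Y ⋖ X}
    {h₁' : Z ⋖ Y'} {h₂' : Y' ⋖ X} (h : pathTwo h₁ h₂ = pathTwo h₁' h₂') : Y = Y' :=
  Quiver.Path.obj_eq_of_cons_eq_cons (V := HasseQuiver P) h

theorem repr_sumPathsTwo [Preorder P] [Fintype P] {Z Y X : P} (h₁ : Z ⋖ Y) (h₂ : Y ⋖ X) :
    (basis k (HasseQuiver P)).repr (sumPathsTwo k Z X) ⟨_, _, pathTwo h₁ h₂⟩ = 1 := by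
  classical
  rw [sumPathsTwo, map_sum, Finsupp.finsetSum_apply, Finset.sum_eq_single ⟨Y, h₁, h₂⟩]
  · rw [ofPath, Module.Basis.repr_self]
    exact Finsupp.single_eq_same
  · intro Y' _ hY'
    rw [ofPath, Module.Basis.repr_self, Finsupp.single_eq_of_ne]
    intro h
    injection h with _ _ h
    exact hY' (Subtype.ext (pathTwo_injective h).symm)
  · simp

theorem sumPathsTwo_mem_pathSpan [Preorder P] [Fintype P] {Z X : P}
    {C : QuiverPath (HasseQuiver P) → Prop}
    (h : ∀ (Y : P) (h₁ : Z ⋖ Y) (h₂ : Y ⋖ X), C ⟨_, _, pathTwo h₁ h₂⟩) :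
    sumPathsTwo k Z X ∈ pathSpan k C :=
  Submodule.sum_mem _ fun Y _ => ofPath_mem_pathSpan (h Y.1 Y.2.1 Y.2.2)

theorem length_add_le_of_strictMono [Preorder P] {f : P → ℕ} (hf : StrictMono f)
    {X Y : HasseQuiver P} (p : Quiver.Path X Y) : p.length + f Y ≤ f X := by
  induction p with
  | nil => simp
  | cons p e ih =>
    have := hf e.down.lt
    rw [Quiver.Path.length_cons]
    omega

theorem IntervalLengthTwo.not_lt [PartialOrder P] {Z X : P} (h : IntervalLengthTwo Z X)
    {W Y : P} (h₁ : Z < W) (h₂ : W < Y) : ¬ Y < X := by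
  intro h₃
  have lt3 : ∀ p : LTSeries (Set.Icc Z X), p.length < 3 :=
    Order.krullDim_lt_coe_iff.1 (by rw [h]; norm_cast)
  refine lt_irrefl 3 (lt3 (LTSeries.mk 3 ![⟨Z, le_rfl, (h₁.trans (h₂.trans h₃)).le⟩,
    ⟨W, h₁.le, (h₂.trans h₃).le⟩, ⟨Y, (h₁.trans h₂).le, h₃.le⟩,
    ⟨X, (h₁.trans (h₂.trans h₃)).le, le_rfl⟩] ?_))
  rw [Fin.strictMono_iff_lt_succ]
  intro i
  fin_cases i
  · exact h₁
  · exact h₂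
  · exact h₃

/-- The middle term of a chain of length two; any refinement of the chain would have length three.
-/
theorem IntervalLengthTwo.exists_covBy [PartialOrder P] {Z X : P}
    (h : IntervalLengthTwo Z X) : ∃ Y, Z ⋖ Y ∧ Y ⋖ X := by
  obtain ⟨l, hl⟩ := Order.le_krullDim_iff.1 (show ((2 : ℕ) : WithBot ℕ∞) ≤ _ from h.ge)
  have h₁ : l ⟨0, by omega⟩ < l ⟨1, by omega⟩ := l.strictMono (Fin.mk_lt_mk.2 (by norm_num))
  have h₂ : l ⟨1, by omega⟩ < l ⟨2, by omega⟩ := l.strictMono (Fin.mk_lt_mk.2 (by norm_num))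
  have h₁' : Z < (l ⟨1, by omega⟩).1 := (l ⟨0, by omega⟩).2.1.trans_lt h₁
  have h₂' : (l ⟨1, by omega⟩).1 < X := lt_of_lt_of_le h₂ (l ⟨2, by omega⟩).2.2
  exact ⟨_, ⟨h₁', fun W h h' => IntervalLengthTwo.not_lt ‹_› h h' h₂'⟩,
    ⟨h₂', fun W h h' => IntervalLengthTwo.not_lt ‹_› h₁' h h'⟩⟩

theorem intervalLengthTwo_of_covBy [PartialOrder P] {Z Y X : P} (f : P → ℕ) (hf : StrictMono f)
    (h₁ : Z ⋖ Y) (h₂ : Y ⋖ X) (h : f X = f Z + 2) : IntervalLengthTwo Z X := by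
  refine le_antisymm ?_ ?_
  · refine iSup_le fun l => ?_
    have hm : StrictMono fun W : Set.Icc Z X => f W.1 := fun a b hab => hf hab
    have h1 := LTSeries.head_add_length_le_nat (l.map _ hm)
    have h2 : f Z ≤ f l.head.1 := hf.monotone l.head.2.1
    have h3 : f l.last.1 ≤ f X := hf.monotone l.last.2.2
    have h4 : f l.head.1 + l.length ≤ f l.last.1 := h1
    have h5 : l.length ≤ 2 := by omega
    exact_mod_cast h5
  · refine Order.le_krullDim_iff (n := 2).2 ⟨LTSeries.mk 2 ![⟨Z, le_rfl, (h₁.le.trans h₂.le)⟩,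
      ⟨Y, h₁.le, h₂.le⟩, ⟨X, (h₁.le.trans h₂.le), le_rfl⟩] ?_, rfl⟩
    rw [Fin.strictMono_iff_lt_succ]
    intro i
    fin_cases i
    · exact h₁.lt
    · exact h₂.lt

end HasseQuiver

namespace CentralArrangement

variable {V : Type*} [AddCommGroup V] [Module ℝ V] [FiniteDimensional ℝ V]
  {A : CentralArrangement V} {k : Type*} [Field k] {ε : Orientations A}
  {c : IntersectionLattice A → Face A}

open Face PathAlgebra

theorem strictMono_finrank :
    StrictMono fun X : IntersectionLattice A => Module.finrank ℝ X.1 :=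
  fun _ _ h => finrank_lt_of_lt h

theorem intervalLengthTwo_of_covBy {Z Y X : IntersectionLattice A} (h₁ : Z ⋖ Y) (h₂ : Y ⋖ X) :
    IntervalLengthTwo Z X :=
  _root_.intervalLengthTwo_of_covBy _ strictMono_finrank h₁ h₂
    (by simp only [CovBy.finrank h₂, CovBy.finrank h₁])

/-! ### The homomorphism from the path algebra -/

theorem exists_quiverMap (hc : ∀ X, (c X).support = X) (ε : Orientations A) :
    ∃ φ : PathAlgebra k (FaceQuiver A) →ₐ[k] FaceAlgebra k A, IsQuiverMap ε c φ := by
  obtain ⟨φ, h1, h2⟩ := exists_algHom (k := k) (Q := FaceQuiver A) (B := FaceAlgebra k A)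
    (v := fun X => idem k c X)
    (f := fun {X Y} _ => idem k c Y * boundary k ε (c Y) * idem k c X)
    (fun X => idem_mul_self k hc X) (fun X Y h => idem_mul_idem_of_ne k hc h) (sum_idem k hc)
    (fun {X Y} _ => idem_mul_idem_mul k hc X Y _) (fun {X Y} _ => mul_idem_mul_idem k hc X Y _)
  exact ⟨φ, fun X => h1 X, fun X Y h => h2 X Y _⟩

theorem IsQuiverMap.unique {φ φ' : PathAlgebra k (FaceQuiver A) →ₐ[k] FaceAlgebra k A}
    (h : IsQuiverMap ε c φ) (h' : IsQuiverMap ε c φ') : φ' = φ :=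
  algHom_ext (fun X => (h'.1 X).trans (h.1 X).symm)
    fun X Y e => (h'.2 X Y e.down).trans (h.2 X Y e.down).symm

variable {φ : PathAlgebra k (FaceQuiver A) →ₐ[k] FaceAlgebra k A}

variable (ε) in
open Classical in
/-- The component from the faces of support `Y` to the faces of support `X` of the boundary. -/
noncomputable def bdFun (X Y : IntersectionLattice A) (m : Face A → k) (x : Face A) : k :=
  if x.support = X then ∑ w with w.support = Y, ((inc ε w x : SignType) : k) * m w else 0

theorem theta_mul_coverArrow (hc : ∀ X, (c X).support = X) (hφ : IsQuiverMap ε c φ)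
    (X Y : IntersectionLattice A) (m : Face A → k) :
    theta k c m * φ (coverArrow k X Y) = theta k c (bdFun ε X Y m) := by
  classical
  by_cases h : Y ⋖ X
  · rw [coverArrow_of_covBy h, hφ.2 X Y h, theta_mul_arrow k hc h]
    rfl
  · have : bdFun ε X Y m = 0 := by
      ext x
      rw [bdFun]
      split_ifs with hx
      · refine Finset.sum_eq_zero fun w hw => ?_
        rw [inc_eq_zero, SignType.coe_zero, zero_mul]
        rintro ⟨-, h'⟩
        rw [hx, (Finset.mem_filter.1 hw).2] at h'
        exact h h'
      · rfl
    rw [coverArrow_of_not_covBy h, this, map_zero, map_zero, mul_zero]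

/-- Each face `w` contributes only for `Y = supp w`, so a family `m Y` acts as the single chain `w ↦
m (supp w) w`. -/
theorem sum_bdFun (X : IntersectionLattice A) (m : IntersectionLattice A → Face A → k)
    {x : Face A} (hx : x.support = X) :
    ∑ Y, bdFun ε X Y (m Y) x = ∑ w, ((inc ε w x : SignType) : k) * m w.support w := by
  classical
  simp only [bdFun, if_pos hx, Finset.sum_filter]
  rw [Finset.sum_comm]
  refine Finset.sum_congr rfl fun w _ => ?_
  rw [Finset.sum_ite_eq]
  simp

/-- Right multiplication by this element is a component of the square of the boundary operator,
hence zero; apply it to `1`. -/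
theorem map_sumPathsTwo (hc : ∀ X, (c X).support = X) (hφ : IsQuiverMap ε c φ)
    (Z X : IntersectionLattice A) : φ (sumPathsTwo k Z X) = 0 := by
  classical
  have key : ∀ m, theta k c m * φ (sumPathsTwo k Z X) = 0 := by
    intro m
    rw [sumPathsTwo_eq, map_sum, Finset.mul_sum]
    simp only [map_mul]
    simp only [← mul_assoc, theta_mul_coverArrow hc hφ]
    rw [← map_sum]
    convert map_zero (theta k c)
    ext x
    rw [Finset.sum_apply, Pi.zero_apply]
    by_cases hx : x.support = X
    · rw [sum_bdFun X _ hx]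
      simp only [bdFun, if_true, Finset.mul_sum]
      rw [Finset.sum_comm]
      refine Finset.sum_eq_zero fun z _ => ?_
      have := sum_inc_mul_inc (ε := ε) k z x
      calc _ = (∑ y, ((inc ε z y : SignType) : k) * ((inc ε y x : SignType) : k)) * m z := by
            rw [Finset.sum_mul]
            exact Finset.sum_congr rfl fun y _ => by ring
        _ = 0 := by rw [this, zero_mul]
    · exact Finset.sum_eq_zero fun Y _ => by rw [bdFun, if_neg hx]
  obtain ⟨m, hm⟩ := theta_surjective k hc 1
  have := key m
  rwa [hm, one_mul] at this

/-- Upward induction on `X`. Modulo the image, the faces on the two sides of a wall `w` of `X` give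
the same class: up to sign their difference is `w e_{supp w}`, in the image by induction, times the
image of an arrow. By connectedness every `x e_X` is congruent to `c X * e_X = e_X`. -/
theorem quiverMap_surjective (hc : ∀ X, (c X).support = X) (hφ : IsQuiverMap ε c φ) :
    Function.Surjective φ := by
  classical
  have key : ∀ X : IntersectionLattice A, ∀ x : Face A, x.support = X →
      fc k x * idem k c X ∈ φ.range := by
    intro X
    induction X using WellFoundedLT.induction with
    | ind X ih =>
    have hX : idem k c X ∈ φ.range := ⟨_, hφ.1 X⟩
    intro x hx
    have h1 := eq_of_forall_wall X
      (fun x => (Subalgebra.toSubmodule φ.range).mkQ (fc k x * idem k c X)) 0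
      (by
        intro w _ hw x x' hx hx' hX hX'
        rcases eq_or_eq_flip hx hx' (hX'.trans hX.symm) (by rwa [hX]) with e | e
        · rw [e]
        rw [Submodule.mkQ_apply, Submodule.mkQ_apply, Submodule.Quotient.eq,
          Subalgebra.mem_toSubmodule, e]
        have h2 : bd k ε c X w ∈ φ.range := by
          rw [← fc_mul_idem_mul_bd k hc hw rfl, ← idem_mul_self k hc w.support, ← mul_assoc,
            mul_assoc (fc k w * _), ← idem_mul_boundary_mul_idem k hc hw, ← hφ.2 X _ hw]
          exact mul_mem (ih _ hw.lt w rfl) ⟨_, rfl⟩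
        rw [bd_eq k hx hX hw] at h2
        have h3 := Subalgebra.smul_mem _ h2 ((inc ε w x : SignType) : k)
        rwa [smul_smul, coe_sign_mul_self (inc_ne_zero (by rwa [hX]) hx), one_smul] at h3)
      (x := x) (x' := c X) (fun H => Or.inl rfl) (fun H => Or.inl rfl) hx (hc X)
    simp only [Submodule.mkQ_apply, Submodule.Quotient.eq, Subalgebra.mem_toSubmodule,
      fc_mul_idem_self k hc] at h1
    simpa using add_mem h1 hX
  intro a
  obtain ⟨m, rfl⟩ := theta_surjective k hc a
  change _ ∈ φ.range
  rw [theta_apply]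
  exact sum_mem fun w _ => Subalgebra.smul_mem _ (key _ w rfl) _

/-! ### The kernel is generated by the relations -/

theorem sum_inc_eq_zero {X : IntersectionLattice A} {w : Face A} (h : w.support ⋖ X)
    [DecidableEq (IntersectionLattice A)] :
    ∑ x with x.support = X, ((inc ε w x : SignType) : k) = 0 := by
  obtain ⟨x, hwx, rfl⟩ := exists_support_above h.le
  have := sum_inc_mul (k := k) (ε := ε) hwx h fun _ => 1
  simpa using this

/-- Without an intermediate vertex the sum is empty, so all pairs `Z`, `X` may be used, not only the
intervals of length two. -/
theorem sumPathsTwo_mem_span (Z X : IntersectionLattice A) :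
    sumPathsTwo k Z X ∈ TwoSidedIdeal.span (quiverRelations k A) := by
  classical
  by_cases h : ∃ Y, Z ⋖ Y ∧ Y ⋖ X
  · obtain ⟨Y, h₁, h₂⟩ := h
    exact TwoSidedIdeal.subset_span ⟨Z, X, intervalLengthTwo_of_covBy h₁ h₂, rfl⟩
  · have : sumPathsTwo k Z X = 0 := by
      rw [sumPathsTwo_eq]
      refine Finset.sum_eq_zero fun Y _ => ?_
      by_cases h₁ : Z ⋖ Y
      · rw [coverArrow_of_not_covBy (Y := Y) fun h₂ => h ⟨Y, h₁, h₂⟩, mul_zero]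
      · rw [coverArrow_of_not_covBy h₁, zero_mul]
    rw [this]
    exact zero_mem _

theorem mul_vertex_mem_span (hc : ∀ X, (c X).support = X) (hφ : IsQuiverMap ε c φ)
    (X : IntersectionLattice A) (a : PathAlgebra k (FaceQuiver A))
    (ha : φ (a * vertex k (HasseQuiver.of X)) = 0) :
    a * vertex k (HasseQuiver.of X) ∈ TwoSidedIdeal.span (quiverRelations k A) := by
  classical
  induction X using WellFoundedLT.induction generalizing a with
  | ind X ih =>
  obtain ⟨r, b, hb⟩ := exists_mul_vertex_eq a X
  have hM : ∀ Y, ∃ m, theta k c m = φ (b Y) := fun Y => theta_surjective k hc _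
  choose M hM using hM
  have hX : idem k c X = theta k c (Pi.single (c X) 1) := by
    rw [theta_single, hc, fc_mul_idem_self k hc]
  have h0 : r • Pi.single (c X) 1 + ∑ Y, bdFun ε X Y (M Y) = 0 := by
    apply theta_injective k hc
    rw [map_zero, ← ha, hb, map_add, map_add, map_smul, map_smul, hφ.1, hX, map_sum, map_sum]
    congr 1
    refine Finset.sum_congr rfl fun Y _ => ?_
    rw [map_mul, ← hM, theta_mul_coverArrow hc hφ]
  have h1 : ∀ x : Face A, x.support = X → r * (if x = c X then 1 else 0) +
      ∑ w with w.support ⋖ X, ((inc ε w x : SignType) : k) * M w.support w = 0 := by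
    intro x hx
    have := congrFun h0 x
    rw [Pi.add_apply, Finset.sum_apply, sum_bdFun X _ hx] at this
    rw [Finset.sum_filter_of_ne]
    · simpa [Pi.single_apply] using this
    · intro w _ hw
      have : inc ε w x ≠ 0 := fun h => hw (by simp [h])
      rw [← hx]
      exact (of_inc_ne_zero this).2
  -- Sum the equations `h1` over all faces of support `X`: boundaries have augmentation zero, and
  -- the generator `c X` has augmentation one.
  have hr : r = 0 := by
    have h2 := Finset.sum_eq_zero (s := Finset.univ.filter fun x : Face A => x.support = X)
      (fun x hx => h1 x (Finset.mem_filter.1 hx).2)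
    rw [Finset.sum_add_distrib, Finset.sum_comm] at h2
    have h3 : ∑ w with w.support ⋖ X, ∑ x with x.support = X,
        ((inc ε w x : SignType) : k) * M w.support w = 0 := by
      refine Finset.sum_eq_zero fun w hw => ?_
      rw [← Finset.sum_mul, sum_inc_eq_zero (Finset.mem_filter.1 hw).2, zero_mul]
    rw [h3, add_zero, ← Finset.mul_sum, Finset.sum_ite_eq', if_pos (by simp [hc]), mul_one] at h2
    exact h2
  subst hr
  obtain ⟨n, hn⟩ := exists_boundary (ε := ε) X (fun w => M w.support w) (by
    intro x hx
    have := h1 x hx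
    rwa [zero_mul, zero_add] at this)
  obtain ⟨n', hn'⟩ := quiverMap_surjective hc hφ (theta k c n)
  -- Subtracting the arrows weighted by the lift `n'` of `n` puts the coefficient at `Y` into the
  -- kernel, so the induction hypothesis applies to it.
  have h4 : ∀ Y, Y ⋖ X → (b Y - ∑ Z, n' * coverArrow k Y Z) * vertex k (HasseQuiver.of Y) ∈
      TwoSidedIdeal.span (quiverRelations k A) := by
    intro Y hY
    refine ih Y hY.lt _ ?_
    have e : (b Y - ∑ Z, n' * coverArrow k Y Z) * vertex k (HasseQuiver.of Y) =
        b Y * vertex k (HasseQuiver.of Y) - ∑ Z, n' * coverArrow k Y Z := by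
      rw [sub_mul, Finset.sum_mul]
      simp only [mul_assoc, coverArrow_mul_vertex]
    rw [e, map_sub, map_sum, map_mul, hφ.1, ← hM, theta_mul_idem k hc, sub_eq_zero]
    simp only [map_mul, hn', theta_mul_coverArrow hc hφ]
    rw [← map_sum]
    congr 1
    ext y
    rw [Finset.sum_apply]
    split_ifs with hy
    · rw [sum_bdFun Y (fun _ => n) hy]
      subst hy
      exact hn y hY
    · exact (Finset.sum_eq_zero fun Z _ => by rw [bdFun, if_neg hy]).symm
  -- What was subtracted regroups, by the endpoint `Z`, into `n'` times the sums of paths of length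
  -- two.
  have h5 : ∑ Y, b Y * coverArrow k X Y =
      ∑ Y, (b Y - ∑ Z, n' * coverArrow k Y Z) * vertex k (HasseQuiver.of Y) * coverArrow k X Y
        + ∑ Z, n' * sumPathsTwo k Z X := by
    simp only [sumPathsTwo_eq, Finset.mul_sum]
    rw [Finset.sum_comm (γ := IntersectionLattice A), ← Finset.sum_add_distrib]
    refine Finset.sum_congr rfl fun Y _ => ?_
    rw [mul_assoc _ (vertex k _), vertex_mul_coverArrow, sub_mul, Finset.sum_mul]
    simp only [mul_assoc]
    abel
  rw [hb, zero_smul, zero_add, h5]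
  refine add_mem (sum_mem fun Y _ => ?_) (sum_mem fun Z _ => ?_)
  · by_cases hY : Y ⋖ X
    · exact TwoSidedIdeal.mul_mem_right _ _ _ (h4 Y hY)
    · rw [coverArrow_of_not_covBy hY, mul_zero]
      exact zero_mem _
  · exact TwoSidedIdeal.mul_mem_left _ _ _ (sumPathsTwo_mem_span Z X)

theorem span_quiverRelations (hc : ∀ X, (c X).support = X) (hφ : IsQuiverMap ε c φ) :
    TwoSidedIdeal.span (quiverRelations k A) = TwoSidedIdeal.ker φ := by
  refine le_antisymm ?_ fun a ha => ?_
  · rw [TwoSidedIdeal.span_le]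
    rintro _ ⟨Z, X, -, rfl⟩
    exact (TwoSidedIdeal.mem_ker _).2 (map_sumPathsTwo hc hφ Z X)
  · rw [TwoSidedIdeal.mem_ker] at ha
    rw [← mul_one a, one_def, Finset.mul_sum]
    refine sum_mem fun X _ => ?_
    exact mul_vertex_mem_span hc hφ X a (by rw [map_mul, ha, zero_mul])

/-! ### Admissibility and minimality -/

theorem isAdmissible_ker (hc : ∀ X, (c X).support = X) (hφ : IsQuiverMap ε c φ) :
    IsAdmissible (TwoSidedIdeal.ker φ) := by
  -- Dimensions drop along arrows, so no path is longer than `finrank V`; the summand `2` secures `r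
  -- ≥ 2` even when `V` is zero.
  refine ⟨⟨Module.finrank ℝ V + 2, by omega, fun x hx => ?_⟩, fun x hx => ?_⟩
  · have h1 := arrowIdeal_pow_le _ hx
    have h2 : lengthSpan k (FaceQuiver A) (Module.finrank ℝ V + 2) = ⊥ := by
      rw [eq_bot_iff, lengthSpan, pathSpan, Submodule.span_le]
      rintro _ ⟨X, Y, p, hp, rfl⟩
      have h3 := length_add_le_of_strictMono strictMono_finrank p
      have h4 : ∀ W : IntersectionLattice A,
          (fun W : IntersectionLattice A => Module.finrank ℝ W.1) W ≤ Module.finrank ℝ V :=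
        fun W => Submodule.finrank_le _
      have h5 : p.length ≤ Module.finrank ℝ V :=
        ((Nat.le_add_right _ _).trans h3).trans (h4 X)
      have h6 : Module.finrank ℝ V + 2 ≤ p.length := hp
      omega
    rw [h2, Submodule.mem_bot] at h1
    rw [h1]
    exact zero_mem _
  · rw [← span_quiverRelations hc hφ] at hx
    apply lengthSpan_two_le
    have : TwoSidedIdeal.span (quiverRelations k A) ≤
        pathIdeal (k := k) (fun p => 2 ≤ p.path.length)
        (fun p q h => by simp only [Quiver.Path.length_comp] at h ⊢; omega)
        (fun p q h => by simp only [Quiver.Path.length_comp] at h ⊢; omega) := by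
      rw [TwoSidedIdeal.span_le]
      rintro _ ⟨Z, X, -, rfl⟩
      exact mem_pathIdeal.2 (sumPathsTwo_mem_pathSpan fun _ _ _ => le_rfl)
    exact mem_pathIdeal.1 (this hx)

theorem span_ne_of_ssubset {S : Set (PathAlgebra k (FaceQuiver A))}
    (hS : S ⊂ quiverRelations k A) :
    TwoSidedIdeal.span S ≠ TwoSidedIdeal.span (quiverRelations k A) := by
  intro h
  obtain ⟨x, hx, hxS⟩ := Set.exists_of_ssubset hS
  obtain ⟨Z, X, hZX, rfl⟩ := hx
  obtain ⟨Y, h₁, h₂⟩ := hZX.exists_covBy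
  -- All paths of length at least two except those of length two from `X` to `Z` span an ideal,
  -- since a factor of length two in a product of length two leaves only a trivial cofactor. The
  -- ideal contains every sum in `S`, whose endpoints differ from `(X, Z)`, but not the omitted sum,
  -- where `X → Y → Z` has coefficient one.
  have hle : TwoSidedIdeal.span S ≤ pathIdeal (k := k) (Q := FaceQuiver A)
      (fun p => 2 ≤ p.path.length ∧
        ¬ (p.path.length = 2 ∧ p.source = HasseQuiver.of X ∧ p.target = HasseQuiver.of Z))
      (by
        intro a b c p q
        simp only [Quiver.Path.length_comp]
        rintro ⟨h3, h4⟩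
        refine ⟨by omega, fun h5 => h4 ⟨by omega, h5.2.1, ?_⟩⟩
        exact (q.eq_of_length_zero (by omega)).trans h5.2.2)
      (by
        intro a b c p q
        simp only [Quiver.Path.length_comp]
        rintro ⟨h3, h4⟩
        refine ⟨by omega, fun h5 => h4 ⟨by omega, ?_, h5.2.2⟩⟩
        exact (p.eq_of_length_zero (by omega)).symm.trans h5.2.1) := by
    rw [TwoSidedIdeal.span_le]
    intro s hs
    obtain ⟨Z', X', -, rfl⟩ := hS.1 hs
    refine mem_pathIdeal.2 (sumPathsTwo_mem_pathSpan fun Y' _ _ => ⟨le_rfl, ?_⟩)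
    rintro ⟨-, h3, h4⟩
    apply hxS
    have h3' : X' = X := h3
    have h4' : Z' = Z := h4
    rwa [← h3', ← h4']
  have hmem : sumPathsTwo k Z X ∈ TwoSidedIdeal.span S := by
    rw [h]
    exact sumPathsTwo_mem_span Z X
  have h0 := repr_eq_zero_of_mem_pathSpan (mem_pathIdeal.1 (hle hmem))
    (p := ⟨_, _, pathTwo h₁ h₂⟩) (fun h => h.2 ⟨rfl, rfl, rfl⟩)
  rw [repr_sumPathsTwo] at h0
  exact one_ne_zero h0

theorem isMinimalRelations_ker (hc : ∀ X, (c X).support = X) (hφ : IsQuiverMap ε c φ) :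
    IsMinimalRelations (TwoSidedIdeal.ker φ) (quiverRelations k A) := by
  refine ⟨?_, span_quiverRelations hc hφ, fun S hS => ?_⟩
  · rintro _ ⟨Z, X, -, rfl⟩
    refine ⟨HasseQuiver.of X, HasseQuiver.of Z,
      (TwoSidedIdeal.mem_ker _).2 (map_sumPathsTwo hc hφ Z X), ?_⟩
    exact Submodule.sum_mem _ fun Y _ => Submodule.subset_span ⟨_, rfl⟩
  · rw [← span_quiverRelations hc hφ]
    exact span_ne_of_ssubset hS

/-- The homomorphism theorem for a surjective homomorphism and a two-sided ideal. -/
theorem exists_quotient_algEquiv {R B : Type*} [Ring R] [Algebra k R] [Ring B] [Algebra k B]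
    (φ : R →ₐ[k] B) (hs : Function.Surjective φ) (I : TwoSidedIdeal R)
    (hI : I = TwoSidedIdeal.ker φ) :
    ∃ ψ : I.ringCon.Quotient ≃ₐ[k] B, ∀ a : R, ψ a = φ a := by
  subst hI
  let e : (TwoSidedIdeal.ker φ).ringCon.Quotient ≃+* B :=
    RingCon.quotientKerEquivOfSurjective φ.toRingHom hs
  exact ⟨AlgEquiv.ofRingEquiv (f := e) fun r => φ.commutes r, fun a => rfl⟩

end CentralArrangement

theorem mainTheorem6 {k : Type*} [Field k] {V : Type*} [AddCommGroup V] [Module ℝ V]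
    [FiniteDimensional ℝ V] (A : CentralArrangement V)
    (c : A.IntersectionLattice → A.Face) (hc : ∀ X, (c X).support = X)
    (ε : A.Orientations) :
    ∃ φ : PathAlgebra k A.FaceQuiver →ₐ[k] A.FaceAlgebra k,
      CentralArrangement.IsQuiverMap ε c φ ∧
      (∀ φ', CentralArrangement.IsQuiverMap ε c φ' → φ' = φ) ∧
      (∀ Z X : A.IntersectionLattice, IntervalLengthTwo Z X →
        φ (sumPathsTwo k Z X) = 0) ∧
      PathAlgebra.IsAdmissible (TwoSidedIdeal.ker φ) ∧
      PathAlgebra.IsMinimalRelations (TwoSidedIdeal.ker φ) (A.quiverRelations k) ∧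
      ∃ ψ : (TwoSidedIdeal.span (A.quiverRelations k)).ringCon.Quotient ≃ₐ[k] A.FaceAlgebra k,
        ∀ a : PathAlgebra k A.FaceQuiver, ψ a = φ a := by
  obtain ⟨φ, hφ⟩ := CentralArrangement.exists_quiverMap (k := k) hc ε
  exact ⟨φ, hφ, fun φ' h' => hφ.unique h',
    fun Z X _ => CentralArrangement.map_sumPathsTwo hc hφ Z X,
    CentralArrangement.isAdmissible_ker hc hφ, CentralArrangement.isMinimalRelations_ker hc hφ,
    CentralArrangement.exists_quotient_algEquiv φ
      (CentralArrangement.quiverMap_surjective hc hφ) _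
      (CentralArrangement.span_quiverRelations hc hφ)⟩
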